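/- Let $n\ge 3$, let $A=\mathrm{diag}(A_1,\dots,A_n)$ with all $A_i>0$, and let $I\subset\mathbb R$ be an open interval. Write $x\wedge y=xy^T-yx^T$ and $\langle X,Y\rangle=-\tfrac12\mathrm{tr}(XY)$ on $so(n)$, and let $\mathcal I:so(n)\to so(n)$ be the linear operator with $\mathcal I(E_i\wedge E_j)=\frac{A_iA_j}{\det A}E_i\wedge E_j$, where $E_1,\dots,E_n$ is the standard basis of $\mathbb R^n$. The (unreduced) Veselova LR system is the following system for $g(t)\in SO(n)$, $\omega=g^{-1}\dot g$, $e_i=g^{-1}E_i$ (so that $\dot e_i=-\omega e_i$): $$\langle\omega,e_a\wedge e_b\rangle=0\quad(2\le a<b\le n),\qquad \frac{d}{dt}(\mathcal I\omega)=[\mathcal I\omega,\omega]+\sum_{2\le a<b\le n}\lambda_{ab}\,e_a\wedge e_b ,$$ with Lagrange multipliers $\lambda_{ab}$. It projects by $q=e_1$, $p=\frac1{\det A}\big[(q,Aq)A\dot q-(\dot q,Aq)Aq\big]$ onto the reduced system on $T^*S^{n-1}=\{(q,q)=1,\ (q,p)=0\}$, $$\dot q=\frac{\det A}{(q,Aq)}\big[A^{-1}p-(p,A^{-1}q)q\big],\qquad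 \dot p=-\det A\,\frac{(p,A^{-1}p)-(p,q)(q,A^{-1}p)}{(q,Aq)}\,q .$$ Let $(q(t),p(t))$, $t\in I$, be a solution of the reduced system that is not an equilibrium ($p\ne0$ at some time). Put $X=(q,Aq)^{-1/2}Aq$, let $s$ be the arc length of the curve $X$, $\gamma=dX/ds$ its unit tangent, $\Pi_\gamma=\mathrm{Id}-\gamma\otimes\gamma$, and $\mathcal L=\Pi_\gamma(A-X\otimes X)\Pi_\gamma$. Let $Q(\alpha)=\{x\in\mathbb R^n:\sum_i x_i^2/(\alpha-A_i)=-1\}$ for $\alpha\notin\{A_1,\dots,A_n\}$. Then: 1. $X$ is a regular curve on $Q(0)$, and it is a geodesic of $Q(0)$ in the parameter $s$. The energy $h=\frac1{2\det A}\big[(A\dot q,\dot q)(Aq,q)-(Aq,\dot q)^2\big]$ is a positive constant, and $$\frac{ds}{dt}=\sqrt{\frac{(X,A^{-2}X)}{(\gamma,A^{-1}\gamma)}}\,\sqrt{\det A\,\frac{2h}{(Aq,q)}} .$$ 2. There are constants $\alpha_2,\dots,\alpha_{n-1}$ such that for all $t\in I$ the characteristic polynomial of $\mathcal L(t)$ is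 $z^2\prod_{k=2}^{n-1}(z-\alpha_k)$. There are unit vectors $\mathfrak n_k(t)$, $2\le k\le n-1$, continuous in $t$, with $\mathcal L\mathfrak n_k=\alpha_k\mathfrak n_k$ and $\det(q,\mathfrak n_2,\dots,\mathfrak n_{n-1},\gamma)>0$, such that the frame $$e_1=q(t),\quad e_2=\mathfrak n_2(t),\ \dots,\ e_{n-1}=\mathfrak n_{n-1}(t),\quad e_n=\gamma(t)$$ together with $\omega=q\wedge\dot q$ is a solution of the LR system (in particular the frame is orthonormal and positively oriented). 3. If the $\alpha_k$ are pairwise distinct (the generic case), then for every choice of continuous unit vectors $\mathfrak n_k$ with $\mathcal L\mathfrak n_k=\alpha_k\mathfrak n_k$ and $\det(q,\mathfrak n_2,\dots,\mathfrak n_{n-1},\gamma)>0$ this frame, with $\omega=q\wedge\dot q$, is a solution of the LR system. Moreover, whenever $\alpha_k\notin\{A_1,\dots,A_n\}$, at each time $t\in I$ the tangent line $\{X+\sigma\gamma\}$ touches the confocal quadric $Q(\alpha_k)$ (at a point that may be at infinity), and $\mathfrak n_k$ is normal to $Q(\alpha_k)$ at the touching point. (The normal at the point $[y:w]$ of the projective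 closure $\sum_i y_i^2/(\alpha-A_i)+w^2=0$ of $Q(\alpha)$ is the vector with components $y_i/(\alpha-A_i)$.) 4. Let $(q,\mathfrak n_2,\dots,\mathfrak n_{n-1},\gamma)$ be any frame formed with such $\mathfrak n_k$ (continuous unit vectors, $\mathcal L\mathfrak n_k=\alpha_k\mathfrak n_k$, positive determinant) that is a solution with $\omega=q\wedge\dot q$. The solutions of the LR system on $I$ that project onto $(q(t),p(t))$ are exactly those with $\omega=q\wedge\dot q$, $e_1=q$ and $$(e_2(t)\ \cdots\ e_n(t))=(\mathfrak n_2(t)\ \cdots\ \mathfrak n_{n-1}(t)\ \gamma(t))\,\mathfrak R$$ for a constant matrix $\mathfrak R\in SO(n-1)$. -/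

import Mathlib

open Matrix

noncomputable section

namespace Veselova

/-! Vectors of `ℝⁿ` are functions `Fin n → ℝ` with the scalar product `x ⬝ᵥ y`; a positive diagonal
matrix `A = diag (A₁, …, Aₙ)` is given by its entries `A : Fin n → ℝ`, so that the vector `A x` is the
pointwise product `A * x` and `A⁻¹ x` is `A⁻¹ * x`. Indices start at `0`. -/

/-- `x ∧ y = x yᵀ - y xᵀ`, an element of `so(n)`. -/
def wedge {n : ℕ} (x y : Fin n → ℝ) : Matrix (Fin n) (Fin n) ℝ :=
  vecMulVec x y - vecMulVec y x

/-- The Killing scalar product `⟨X, Y⟩ = -½ tr (X Y)` on `so(n)`. -/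
def killing {n : ℕ} (X Y : Matrix (Fin n) (Fin n) ℝ) : ℝ := -(1 / 2) * (X * Y).trace

/-- `det A` for `A = diag (A₁, …, Aₙ)`. -/
def detA {n : ℕ} (A : Fin n → ℝ) : ℝ := ∏ i, A i

/-- The inertia operator: the linear map with `E_i ∧ E_j ↦ (A_i A_j / det A) E_i ∧ E_j`. -/
def inertia {n : ℕ} (A : Fin n → ℝ) (ω : Matrix (Fin n) (Fin n) ℝ) : Matrix (Fin n) (Fin n) ℝ :=
  Matrix.of fun i j => A i * A j / detA A * ω i j

theorem inertia_wedge_basis {n : ℕ} (A : Fin n → ℝ) (i j : Fin n) :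
    inertia A (wedge (Pi.single i 1) (Pi.single j 1)) =
      (A i * A j / detA A) • wedge (Pi.single i 1) (Pi.single j 1) := by
  ext a b
  simp only [inertia, wedge, vecMulVec_apply, of_apply, Matrix.sub_apply, Matrix.smul_apply, smul_eq_mul,
    Pi.single_apply]
  split_ifs <;> subst_vars <;> ring

/-- Solutions `(g, ġ)`, `ω = g⁻¹ ġ`, over the time interval `I`, of the LR system on the
right-invariant distribution `D ⊂ T SO(n)`, `n = k + 1`, in the left trivialization. The vectors
`e_i = g⁻¹ E_i` are the rows `g t i` of the orthogonal matrix `g t`. -/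
structure IsLRSolution {k : ℕ} (A : Fin (k + 1) → ℝ) (I : Set ℝ)
    (g ω : ℝ → Matrix (Fin (k + 1)) (Fin (k + 1)) ℝ) : Prop where
  mem_SO : ∀ t ∈ I, g t ∈ specialOrthogonalGroup (Fin (k + 1)) ℝ
  /-- `ġ = g ω` -/
  kinematic : ∀ t ∈ I, ∀ i j, HasDerivAt (fun u => g u i j) ((g t * ω t) i j) t
  /-- `⟨ω, e_a ∧ e_b⟩ = 0` for all `a < b` different from the first index -/
  constraint : ∀ t ∈ I, ∀ a b : Fin k, a < b →
    killing (ω t) (wedge (g t a.succ) (g t b.succ)) = 0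
  /-- `d/dt (𝓘 ω) = [𝓘 ω, ω] + ∑ λ_ab e_a ∧ e_b` with Lagrange multipliers `λ_ab` -/
  dynamic : ∀ t ∈ I, ∃ lam : Fin k → Fin k → ℝ, ∀ i j,
    HasDerivAt (fun u => inertia A (ω u) i j)
      ((inertia A (ω t) * ω t - ω t * inertia A (ω t) +
        ∑ a, ∑ b ∈ Finset.Ioi a, lam a b • wedge (g t a.succ) (g t b.succ)) i j) t

/-- The reduced Lagrangian `L(q, q̇)` on `T Sⁿ⁻¹`. -/
def reducedLagrangian {n : ℕ} (A q v : Fin n → ℝ) : ℝ :=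
  1 / (2 * detA A) * (((A * v) ⬝ᵥ v) * ((A * q) ⬝ᵥ q) - ((A * q) ⬝ᵥ v) ^ 2)

/-- The momentum `p = ∂L/∂q̇`. -/
def momentum {n : ℕ} (A q v : Fin n → ℝ) : Fin n → ℝ :=
  (1 / detA A) • ((q ⬝ᵥ (A * q)) • (A * v) - (v ⬝ᵥ (A * q)) • (A * q))

/-- Solutions `(q, p)` over `I` of the reduced LR system on
`T^* Sⁿ⁻¹ = {(q, q) = 1, (q, p) = 0} ⊂ ℝ²ⁿ`. -/
structure IsReducedSolution {n : ℕ} (A : Fin n → ℝ) (I : Set ℝ) (q p : ℝ → Fin n → ℝ) : Prop where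
  sphere : ∀ t ∈ I, q t ⬝ᵥ q t = 1
  cotangent : ∀ t ∈ I, q t ⬝ᵥ p t = 0
  q_eq : ∀ t ∈ I, HasDerivAt q
    ((detA A / (q t ⬝ᵥ (A * q t))) • (A⁻¹ * p t - (p t ⬝ᵥ (A⁻¹ * q t)) • q t)) t
  p_eq : ∀ t ∈ I, HasDerivAt p
    (-(detA A * (p t ⬝ᵥ (A⁻¹ * p t) - (p t ⬝ᵥ q t) * (q t ⬝ᵥ (A⁻¹ * p t))) /
      (q t ⬝ᵥ (A * q t))) • q t) t

/-- `(g, ω)` projects onto `(q, p)` under `D → T Sⁿ⁻¹ ≅ T^* Sⁿ⁻¹`: `e_1 = q`, and `p` is the momentum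
of the velocity `ė_1 = -ω e_1`. -/
def ProjectsTo {k : ℕ} (A : Fin (k + 1) → ℝ) (I : Set ℝ)
    (g ω : ℝ → Matrix (Fin (k + 1)) (Fin (k + 1)) ℝ) (q p : ℝ → Fin (k + 1) → ℝ) : Prop :=
  ∀ t ∈ I, g t 0 = q t ∧ momentum A (g t 0) (-(ω t *ᵥ g t 0)) = p t

/-- The confocal quadric `Q(α) = {x | ∑ x_i² / (α - A_i) = -1}`, for `α` different from all `A_i`. -/
def confocalQuadric {n : ℕ} (A : Fin n → ℝ) (α : ℝ) : Set (Fin n → ℝ) :=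
  {x | ∑ i, x i ^ 2 / (α - A i) = -1}

/-- Half the gradient at `x` of the function that defines `Q(α)`: a normal vector of `Q(α)` at `x`. -/
def quadricNormal {n : ℕ} (A : Fin n → ℝ) (α : ℝ) (x : Fin n → ℝ) : Fin n → ℝ :=
  fun i => x i / (α - A i)

/-- The unit tangent `dc/ds` of a regular curve `c`, `s` being a natural parameter. -/
def unitTangent {n : ℕ} (c : ℝ → Fin n → ℝ) (t : ℝ) : Fin n → ℝ :=
  (√(deriv c t ⬝ᵥ deriv c t))⁻¹ • deriv c t

/-- `c` is a regular curve on `Q(α)` that is a geodesic in its natural parameter: the derivative of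
the unit tangent is normal to `Q(α)`. -/
structure IsGeodesicOn {n : ℕ} (A : Fin n → ℝ) (α : ℝ) (I : Set ℝ) (c : ℝ → Fin n → ℝ) : Prop where
  mem : ∀ t ∈ I, c t ∈ confocalQuadric A α
  differentiable : ∀ t ∈ I, DifferentiableAt ℝ c t
  regular : ∀ t ∈ I, deriv c t ≠ 0
  normal : ∀ t ∈ I, ∃ κ : ℝ, HasDerivAt (unitTangent c) (κ • quadricNormal A α (c t)) t

/-- The curve `X = (q, A q)^{-1/2} A q` on `Q(0)` with unit normal `q`. -/
def geodesicCurve {n : ℕ} (A : Fin n → ℝ) (q : ℝ → Fin n → ℝ) (t : ℝ) : Fin n → ℝ :=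
  (√(q t ⬝ᵥ (A * q t)))⁻¹ • (A * q t)

/-- The vector `γ = dX/ds`. -/
def gam {n : ℕ} (A : Fin n → ℝ) (q : ℝ → Fin n → ℝ) : ℝ → Fin n → ℝ :=
  unitTangent (geodesicCurve A q)

/-- `Π_γ = Id - (γ, γ)⁻¹ γ ⊗ γ`. -/
def orthProj {n : ℕ} (v : Fin n → ℝ) : Matrix (Fin n) (Fin n) ℝ :=
  1 - (v ⬝ᵥ v)⁻¹ • vecMulVec v v

/-- Moser's matrix `𝓛 = Π_γ (A - x ⊗ x) Π_γ` of the line `{x + σ γ}`. -/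
def laxMatrix {n : ℕ} (A x v : Fin n → ℝ) : Matrix (Fin n) (Fin n) ℝ :=
  orthProj v * (diagonal A - vecMulVec x x) * orthProj v

/-- `𝓛` along the tangent lines of the curve `X`. -/
def laxCurve {n : ℕ} (A : Fin n → ℝ) (q : ℝ → Fin n → ℝ) (t : ℝ) : Matrix (Fin n) (Fin n) ℝ :=
  laxMatrix A (geodesicCurve A q t) (gam A q t)

/-- The line `{x + σ v}` touches `Q(α)` at the point with homogeneous coordinates `[y : w]`: the
point is on the projective line and on the projective closure `∑ y_i² / (α - A_i) + w² = 0` of `Q(α)`,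
and the tangent hyperplane there contains `[v : 0]` and `[x : 1]`, hence the line.
For `w = 1`: `y = x + σ v ∈ Q(α)` and `v` is tangent to `Q(α)` at `y` (the last condition
then follows from the others). For `w = 0` the touching point is at infinity. -/
def TouchesAt {n : ℕ} (A : Fin n → ℝ) (α : ℝ) (x v y : Fin n → ℝ) (w : ℝ) : Prop :=
  y ≠ 0 ∧ (∃ σ : ℝ, y = w • x + σ • v) ∧ ∑ i, y i ^ 2 / (α - A i) + w ^ 2 = 0 ∧
    quadricNormal A α y ⬝ᵥ v = 0 ∧ quadricNormal A α y ⬝ᵥ x + w = 0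

/-- The matrix with the rows `e_1 = q`, `e_2 = 𝔫_2`, …, `e_{n-1} = 𝔫_{n-1}`, `e_n = γ`, where
`n = m + 2` and `N : Fin m → ℝ → ℝⁿ` lists `𝔫_2, …, 𝔫_{n-1}`. -/
def frame {m : ℕ} (A : Fin (m + 2) → ℝ) (q : ℝ → Fin (m + 2) → ℝ)
    (N : Fin m → ℝ → Fin (m + 2) → ℝ) (t : ℝ) : Matrix (Fin (m + 2)) (Fin (m + 2)) ℝ :=
  Matrix.of (Fin.cons (q t) (Fin.snoc (α := fun _ => Fin (m + 2) → ℝ) (fun j => N j t) (gam A q t)))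

/-- `N` lists unit eigenvectors `𝔫_2, …, 𝔫_{n-1}` of `𝓛` with the eigenvalues `α_2, …, α_{n-1}`,
continuous in time and with the signs chosen so that `(q, 𝔫_2, …, 𝔫_{n-1}, γ)` is positively
oriented. -/
structure IsNormalFamily {m : ℕ} (A : Fin (m + 2) → ℝ) (I : Set ℝ) (q : ℝ → Fin (m + 2) → ℝ)
    (α : Fin m → ℝ) (N : Fin m → ℝ → Fin (m + 2) → ℝ) : Prop where
  continuousOn : ∀ j, ContinuousOn (N j) I
  unit : ∀ t ∈ I, ∀ j, N j t ⬝ᵥ N j t = 1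
  eigenvector : ∀ t ∈ I, ∀ j, laxCurve A q t *ᵥ N j t = α j • N j t
  oriented : ∀ t ∈ I, 0 < (frame A q N t).det

end Veselova

end

/-!
Put `ω = q ∧ q̇` and call a vector `x(t)` with `ẋ = -ωx` transported. Inner products of transported
vectors are constant. The reduced equations say that `q` and `p` are transported, and `Ẋ` is a
positive multiple of `p`; hence `γ = p / |p|` is transported as well, and `γ̇` is proportional to
`q`, that is, to the normal of `Q(0)` at `X`, so `X` is a geodesic.

Solutions of the LR system over `(q, p)` are exactly the transported positively oriented orthonormal
frames with first vector `q`: the constraint and the kinematic equation force `ω = q ∧ q̇`, and the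
multipliers exist because the skew matrix `d/dt (𝓘ω) - [𝓘ω, ω]` annihilates `q`, as one sees by
differentiating `𝓘(ω) q = -p`. Two such frames differ by a constant rotation fixing `q`.

The numbers `(x, 𝓛 y)` are constant for transported `x`, `y` orthogonal to `q` and `γ`, while
`𝓛 q = 𝓛 γ = 0`. Transporting an orthonormal eigenbasis of `𝓛(t₀)` therefore produces eigenvectors
of `𝓛(t)` with constant eigenvalues. On the complement of `q` and `γ` the matrix `𝓛` is positive, so
distinct `α_k` determine the eigenvectors up to sign, and continuity makes the signs constant.
-/

noncomputable section

namespace Veselova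

section LinearODE

open Set

variable {E : Type*} [NormedAddCommGroup E] [NormedSpace ℝ E]

theorem exists_mem_Ioo_Icc_subset {I : Set ℝ} (hI : IsOpen I) (hI' : I.OrdConnected) {s t : ℝ}
    (hs : s ∈ I) (ht : t ∈ I) : ∃ a b, s ∈ Ioo a b ∧ t ∈ Ioo a b ∧ Icc a b ⊆ I := by
  have hlt : ∀ u ∈ I, ∃ a ∈ I, a < u := fun u hu => by
    obtain ⟨a, ha, haI⟩ := mem_nhdsLE_iff_exists_Icc_subset.1 (nhdsWithin_le_nhds (hI.mem_nhds hu))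
    exact ⟨a, haI ⟨le_rfl, ha.le⟩, ha⟩
  have hgt : ∀ u ∈ I, ∃ b ∈ I, u < b := fun u hu => by
    obtain ⟨b, hb, hbI⟩ := mem_nhdsGE_iff_exists_Icc_subset.1 (nhdsWithin_le_nhds (hI.mem_nhds hu))
    exact ⟨b, hbI ⟨hb.le, le_rfl⟩, hb⟩
  obtain ⟨a, ha, hmin⟩ := hlt (min s t) (by rcases min_choice s t with h | h <;> rwa [h])
  obtain ⟨b, hb, hmax⟩ := hgt (max s t) (by rcases max_choice s t with h | h <;> rwa [h])
  rw [lt_min_iff] at hmin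
  rw [max_lt_iff] at hmax
  exact ⟨a, b, ⟨hmin.1, hmax.1⟩, ⟨hmin.2, hmax.2⟩, hI'.out ha hb⟩

/-- The radial retraction of a normed space onto the closed ball of radius `R` around `0`. It makes
a linear vector field bounded, so that Picard–Lindelöf applies on a whole time interval. -/
def ballRetraction (R : ℝ) (x : E) : E := (R / max R ‖x‖) • x

variable {R : ℝ} {x : E}

theorem ballRetraction_of_norm_le (hR : 0 < R) (hx : ‖x‖ ≤ R) : ballRetraction R x = x := by
  rw [ballRetraction, max_eq_left hx, div_self hR.ne', one_smul]

theorem norm_ballRetraction (hR : 0 < R) (x : E) : ‖ballRetraction R x‖ = R * ‖x‖ / max R ‖x‖ := by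
  rw [ballRetraction, norm_smul, Real.norm_of_nonneg (by positivity), div_mul_eq_mul_div]

theorem norm_ballRetraction_le_radius (hR : 0 < R) (x : E) : ‖ballRetraction R x‖ ≤ R := by
  rw [norm_ballRetraction hR, div_le_iff₀ (by positivity)]
  gcongr
  exact le_max_right R ‖x‖

theorem norm_ballRetraction_le_norm (hR : 0 < R) (x : E) : ‖ballRetraction R x‖ ≤ ‖x‖ := by
  rw [norm_ballRetraction hR, div_le_iff₀ (by positivity), mul_comm]
  gcongr
  exact le_max_left R ‖x‖

theorem lipschitzWith_ballRetraction (hR : 0 < R) :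
    LipschitzWith 2 (ballRetraction R : E → E) := by
  refine LipschitzWith.of_dist_le_mul fun x y => ?_
  have hx : 0 < max R ‖x‖ := by positivity
  have hy : 0 < max R ‖y‖ := by positivity
  have hsplit : ballRetraction R x - ballRetraction R y =
      (R / max R ‖x‖) • ((x - y) + ((max R ‖y‖ - max R ‖x‖) / max R ‖y‖) • y) := by
    simp only [ballRetraction]
    match_scalars <;> field_simp
    ring
  have hmax : |max R ‖y‖ - max R ‖x‖| ≤ ‖x - y‖ :=
    (abs_max_sub_max_le_max R ‖y‖ R ‖x‖).trans
      (by simpa [norm_sub_rev x y] using abs_norm_sub_norm_le y x)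
  have htail : ‖((max R ‖y‖ - max R ‖x‖) / max R ‖y‖) • y‖ ≤ ‖x - y‖ := by
    rw [norm_smul, norm_div, Real.norm_eq_abs, Real.norm_of_nonneg hy.le, div_mul_eq_mul_div,
      div_le_iff₀ hy]
    exact mul_le_mul hmax (le_max_right R ‖y‖) (norm_nonneg y) (norm_nonneg _)
  rw [dist_eq_norm, dist_eq_norm, hsplit, norm_smul, Real.norm_of_nonneg (by positivity)]
  calc R / max R ‖x‖ * ‖(x - y) + ((max R ‖y‖ - max R ‖x‖) / max R ‖y‖) • y‖
      ≤ 1 * (‖x - y‖ + ‖x - y‖) := by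
        gcongr
        · exact (div_le_one hx).2 (le_max_left R ‖x‖)
        · exact (norm_add_le _ _).trans (by gcongr)
    _ = (2 : NNReal) * ‖x - y‖ := by push_cast; ring

theorem norm_le_mul_exp_of_norm_deriv_right_le {f f' : ℝ → E} {a b C : ℝ}
    (hf : ∀ t ∈ Icc a b, HasDerivWithinAt f (f' t) (Icc a b) t)
    (hC : ∀ t ∈ Icc a b, ‖f' t‖ ≤ C * ‖f t‖) {t : ℝ} (ht : t ∈ Icc a b) :
    ‖f t‖ ≤ ‖f a‖ * Real.exp (C * (t - a)) := by
  rw [← gronwallBound_ε0]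
  refine norm_le_gronwallBound_of_norm_deriv_right_le (fun t ht => (hf t ht).continuousWithinAt)
    (fun t ht => (hf t (Ico_subset_Icc_self ht)).mono_of_mem_nhdsWithin (Icc_mem_nhdsGE_of_mem ht))
    le_rfl (fun t ht => ?_) t ht
  rw [add_zero]
  exact hC t (Ico_subset_Icc_self ht)

theorem norm_le_mul_exp_of_norm_deriv_le {f f' : ℝ → E} {a b C : ℝ}
    (hf : ∀ t ∈ Icc a b, HasDerivWithinAt f (f' t) (Icc a b) t)
    (hC : ∀ t ∈ Icc a b, ‖f' t‖ ≤ C * ‖f t‖) {s t : ℝ} (hs : s ∈ Icc a b) (ht : t ∈ Icc a b) :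
    ‖f t‖ ≤ ‖f s‖ * Real.exp (C * |t - s|) := by
  rcases le_total s t with hst | hts
  · have hsub : Icc s b ⊆ Icc a b := Icc_subset_Icc_left hs.1
    rw [abs_of_nonneg (sub_nonneg.2 hst)]
    exact norm_le_mul_exp_of_norm_deriv_right_le (fun u hu => (hf u (hsub hu)).mono hsub)
      (fun u hu => hC u (hsub hu)) ⟨hst, ht.2⟩
  · have hmaps : MapsTo (fun u => -u) (Icc (-s) (-a)) (Icc a b) := fun u hu =>
      ⟨by linarith [hu.2], by linarith [hu.1, hs.2]⟩
    have hrev : ∀ u ∈ Icc (-s) (-a),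
        HasDerivWithinAt (fun u => f (-u)) (-f' (-u)) (Icc (-s) (-a)) u := fun u hu => by
      simpa only [neg_smul, one_smul, Function.comp_def] using
        (hf (-u) (hmaps hu)).scomp u (hasDerivAt_neg u).hasDerivWithinAt hmaps
    have h := norm_le_mul_exp_of_norm_deriv_right_le (t := -t) hrev
      (fun u hu => by simpa using hC (-u) (hmaps hu)) ⟨by linarith, by linarith [ht.1]⟩
    rw [abs_of_nonpos (sub_nonpos.2 hts)]
    simpa [neg_add_eq_sub] using h

variable {L : ℝ → E →L[ℝ] E} {t₀ : ℝ}

theorem exists_hasDerivWithinAt_Icc_of_continuousOn_clm [CompleteSpace E] {a b : ℝ}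
    (hL : ContinuousOn L (Icc a b)) (ht₀ : t₀ ∈ Icc a b) (x₀ : E) :
    ∃ f : ℝ → E, f t₀ = x₀ ∧ ∀ t ∈ Icc a b, HasDerivWithinAt f (L t (f t)) (Icc a b) t := by
  obtain ⟨C, hC⟩ := isCompact_Icc.exists_bound_of_continuousOn hL
  lift C to NNReal using (norm_nonneg _).trans (hC t₀ ht₀)
  obtain ⟨R, hR⟩ : ∃ R : NNReal, (R : ℝ) = ‖x₀‖ * Real.exp (C * (b - a)) + 1 :=
    ⟨⟨_, by positivity⟩, rfl⟩
  obtain ⟨T, hT⟩ : ∃ T : NNReal, (T : ℝ) = max (b - t₀) (t₀ - a) :=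
    ⟨⟨_, le_max_of_le_left (sub_nonneg.2 ht₀.2)⟩, rfl⟩
  have hR0 : (0 : ℝ) < R := by rw [hR]; positivity
  have hPL : IsPicardLindelof (fun t x => L t (ballRetraction R x)) (⟨t₀, ht₀⟩ : Icc a b) x₀
      (C * R * T) 0 (C * R) (C * 2) := by
    refine ⟨fun t ht => ?_, fun x _ => hL.clm_apply continuousOn_const, fun t ht x _ => ?_,
      by simp [hT]⟩
    · exact (((L t).lipschitz.weaken (hC t ht)).comp
        (lipschitzWith_ballRetraction hR0)).lipschitzOnWith
    · exact (L t).le_of_opNorm_le_of_le (hC t ht) (norm_ballRetraction_le_radius hR0 x)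
  obtain ⟨f, hf₀, hf⟩ := hPL.exists_eq_forall_mem_Icc_hasDerivWithinAt₀
  have hf₀ : f t₀ = x₀ := hf₀
  have hbound : ∀ t ∈ Icc a b, ‖f t‖ ≤ R := fun t ht => by
    have hgrowth := norm_le_mul_exp_of_norm_deriv_le hf (fun u hu =>
      (L u).le_of_opNorm_le_of_le (hC u hu) (norm_ballRetraction_le_norm hR0 (f u))) ht₀ ht
    have habs : |t - t₀| ≤ b - a :=
      abs_sub_le_iff.2 ⟨by linarith [ht.2, ht₀.1], by linarith [ht.1, ht₀.2]⟩
    calc ‖f t‖ ≤ ‖x₀‖ * Real.exp (C * |t - t₀|) := hf₀ ▸ hgrowth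
      _ ≤ ‖x₀‖ * Real.exp (C * (b - a)) := by gcongr
      _ ≤ R := by rw [hR]; linarith
  refine ⟨f, hf₀, fun t ht => ?_⟩
  simpa only [ballRetraction_of_norm_le hR0 (hbound t ht)] using hf t ht

variable {I : Set ℝ}

theorem eqOn_of_hasDerivAt_clm (hI : IsOpen I) (hI' : I.OrdConnected) (hL : ContinuousOn L I)
    {f g : ℝ → E} (hf : ∀ t ∈ I, HasDerivAt f (L t (f t)) t)
    (hg : ∀ t ∈ I, HasDerivAt g (L t (g t)) t) (ht₀ : t₀ ∈ I) (h : f t₀ = g t₀) : EqOn f g I := by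
  intro t ht
  obtain ⟨a, b, hat₀, hat, hab⟩ := exists_mem_Ioo_Icc_subset hI hI' ht₀ ht
  obtain ⟨C, hC⟩ := isCompact_Icc.exists_bound_of_continuousOn (hL.mono hab)
  have hlip : ∀ u ∈ Ioo a b, LipschitzOnWith C.toNNReal (L u) univ := fun u hu =>
    ((L u).lipschitz.weaken
      (NNReal.le_toNNReal_of_coe_le (hC u (Ioo_subset_Icc_self hu)))).lipschitzOnWith
  exact ODE_solution_unique_of_mem_Ioo hlip hat₀
    (fun u hu => ⟨hf u (hab (Ioo_subset_Icc_self hu)), mem_univ _⟩)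
    (fun u hu => ⟨hg u (hab (Ioo_subset_Icc_self hu)), mem_univ _⟩) h hat

theorem exists_hasDerivAt_of_continuousOn_clm [CompleteSpace E] (hI : IsOpen I)
    (hI' : I.OrdConnected) (hL : ContinuousOn L I) (ht₀ : t₀ ∈ I) (x₀ : E) :
    ∃ f : ℝ → E, f t₀ = x₀ ∧ ∀ t ∈ I, HasDerivAt f (L t (f t)) t := by
  have hloc : ∀ t : I, ∃ (a b : ℝ) (f : ℝ → E), t₀ ∈ Ioo a b ∧ (t : ℝ) ∈ Ioo a b ∧
      Icc a b ⊆ I ∧ f t₀ = x₀ ∧ ∀ s ∈ Ioo a b, HasDerivAt f (L s (f s)) s := fun t => by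
    obtain ⟨a, b, hat₀, hat, hab⟩ := exists_mem_Ioo_Icc_subset hI hI' ht₀ t.2
    obtain ⟨f, hf₀, hf⟩ := exists_hasDerivWithinAt_Icc_of_continuousOn_clm (hL.mono hab)
      (Ioo_subset_Icc_self hat₀) x₀
    exact ⟨a, b, f, hat₀, hat, hab, hf₀, fun s hs =>
      (hf s (Ioo_subset_Icc_self hs)).hasDerivAt (Icc_mem_nhds hs.1 hs.2)⟩
  choose a b f hat₀ hat hab hf₀ hf using hloc
  have hsub : ∀ t : I, Ioo (a t) (b t) ⊆ I := fun t => Ioo_subset_Icc_self.trans (hab t)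
  have hagree : ∀ s t : I, (s : ℝ) ∈ Ioo (a t) (b t) → f s s = f t s := fun s t hst =>
    eqOn_of_hasDerivAt_clm (isOpen_Ioo.inter isOpen_Ioo)
      (ordConnected_Ioo.inter ordConnected_Ioo) (hL.mono (inter_subset_left.trans (hsub s)))
      (fun u hu => hf s u hu.1) (fun u hu => hf t u hu.2) ⟨hat₀ s, hat₀ t⟩
      ((hf₀ s).trans (hf₀ t).symm) ⟨hat s, hst⟩
  classical
  refine ⟨fun t => if h : t ∈ I then f ⟨t, h⟩ t else 0, by simp [ht₀, hf₀], fun t ht => ?_⟩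
  simp only [dif_pos ht]
  refine (hf ⟨t, ht⟩ t (hat ⟨t, ht⟩)).congr_of_eventuallyEq ?_
  filter_upwards [Ioo_mem_nhds (hat ⟨t, ht⟩).1 (hat ⟨t, ht⟩).2] with s hs
  rw [dif_pos (hsub _ hs)]
  exact hagree ⟨s, hsub _ hs⟩ ⟨t, ht⟩ hs

end LinearODE

section Orthonormal

variable {ι : Type*} [Fintype ι]

theorem dotProduct_eq_zero_of_mulVec_eq_smul {S : Matrix ι ι ℝ} (hS : Sᵀ = S) {x y : ι → ℝ}
    {a b : ℝ} (hx : S *ᵥ x = a • x) (hy : S *ᵥ y = b • y) (hab : a ≠ b) : x ⬝ᵥ y = 0 := by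
  have h : a * (x ⬝ᵥ y) = b * (x ⬝ᵥ y) :=
    calc a * (x ⬝ᵥ y) = (S *ᵥ x) ⬝ᵥ y := by rw [hx, smul_dotProduct, smul_eq_mul]
      _ = x ⬝ᵥ (S *ᵥ y) := by rw [dotProduct_mulVec, ← mulVec_transpose, hS]
      _ = b * (x ⬝ᵥ y) := by rw [hy, dotProduct_smul, smul_eq_mul]
  exact (mul_eq_mul_right_iff.1 h).resolve_left hab

theorem dotProduct_mulVec_eq_zero_of_mulVec_eq_zero {S : Matrix ι ι ℝ} (hS : Sᵀ = S) {x : ι → ℝ}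
    (hx : S *ᵥ x = 0) (y : ι → ℝ) : x ⬝ᵥ (S *ᵥ y) = 0 := by
  rw [dotProduct_mulVec, ← mulVec_transpose, hS, hx, zero_dotProduct]

variable [DecidableEq ι] {g : Matrix ι ι ℝ}

theorem dotProduct_row_eq_ite (hg : g * gᵀ = 1) (i j : ι) :
    g i ⬝ᵥ g j = if i = j then 1 else 0 := by
  rw [← one_apply, ← hg]
  rfl

theorem eq_sum_dotProduct_row (hg : g * gᵀ = 1) (x : ι → ℝ) : x = ∑ i, (g i ⬝ᵥ x) • g i :=
  calc x = (g *ᵥ x) ᵥ* g := by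
        rw [← mulVec_transpose, mulVec_mulVec, mul_eq_one_comm.1 hg, one_mulVec]
    _ = ∑ i, (g i ⬝ᵥ x) • g i := vecMul_eq_sum (g *ᵥ x) g

theorem eq_of_forall_dotProduct_row_eq (hg : g * gᵀ = 1) {x y : ι → ℝ}
    (h : ∀ i, g i ⬝ᵥ x = g i ⬝ᵥ y) : x = y := by
  rw [eq_sum_dotProduct_row hg x, eq_sum_dotProduct_row hg y]
  simp only [h]

theorem ext_of_forall_mulVec_row (hg : g * gᵀ = 1) {B C : Matrix ι ι ℝ}
    (h : ∀ j, B *ᵥ g j = C *ᵥ g j) : B = C := by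
  refine ext_of_mulVec_single fun i => ?_
  rw [eq_sum_dotProduct_row hg (Pi.single i 1)]
  simp only [mulVec_sum, mulVec_smul, h]

theorem ext_of_forall_dotProduct_mulVec_row (hg : g * gᵀ = 1) {B C : Matrix ι ι ℝ}
    (h : ∀ i j, g i ⬝ᵥ (B *ᵥ g j) = g i ⬝ᵥ (C *ᵥ g j)) : B = C :=
  ext_of_forall_mulVec_row hg fun j => eq_of_forall_dotProduct_row_eq hg fun i => h i j

theorem eq_sum_vecMulVec_row (hg : g * gᵀ = 1) (B : Matrix ι ι ℝ) :
    B = ∑ i, ∑ j, (g i ⬝ᵥ (B *ᵥ g j)) • vecMulVec (g i) (g j) := by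
  refine ext_of_forall_dotProduct_mulVec_row hg fun a b => ?_
  simp [sum_mulVec, smul_mulVec, vecMulVec_mulVec, dotProduct_sum, dotProduct_smul,
    dotProduct_row_eq_ite hg]

theorem eq_dotProduct_smul_of_forall_ne (hg : g * gᵀ = 1) {x : ι → ℝ} {j : ι}
    (h : ∀ i, i ≠ j → g i ⬝ᵥ x = 0) : x = (g j ⬝ᵥ x) • g j := by
  nth_rw 1 [eq_sum_dotProduct_row hg x]
  exact Finset.sum_eq_single j (fun i _ hi => by rw [h i hi, zero_smul])
    fun hj => absurd (Finset.mem_univ j) hj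

theorem charpoly_of_forall_mulVec_row (hg : g * gᵀ = 1) {S : Matrix ι ι ℝ} {d : ι → ℝ}
    (h : ∀ i, S *ᵥ g i = d i • g i) :
    S.charpoly = ∏ i, (Polynomial.X - Polynomial.C (d i)) := by
  have hS : S = gᵀ * (diagonal d * g) := ext_of_forall_mulVec_row hg fun j => by
    have hj : g *ᵥ g j = Pi.single j 1 := by
      ext i
      rw [Pi.single_apply]
      exact dotProduct_row_eq_ite hg i j
    rw [h, ← mulVec_mulVec, ← mulVec_mulVec, hj, diagonal_mulVec_single, mul_one]
    ext i
    simp [mul_comm]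
  rw [hS, charpoly_mul_comm, Matrix.mul_assoc, hg, Matrix.mul_one, charpoly_diagonal]

end Orthonormal

section Skew

theorem sum_sum_smul_eq_sum_sum_Ioi {k : ℕ} {M : Type*} [AddCommGroup M] [Module ℝ M]
    {c : Fin k → Fin k → ℝ} (hc : ∀ a b, c b a = -c a b) (m : Fin k → Fin k → M) :
    ∑ a, ∑ b, c a b • m a b = ∑ a, ∑ b ∈ Finset.Ioi a, c a b • (m a b - m b a) := by
  have hdiag : ∀ a, c a a = 0 := fun a => by linarith [hc a a]
  calc ∑ a, ∑ b, c a b • m a b = ∑ a, ∑ b ∈ {a}ᶜ, c a b • m a b :=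
        Finset.sum_congr rfl fun a _ => by
          rw [Fintype.sum_eq_add_sum_compl a, hdiag, zero_smul, zero_add]
    _ = ∑ a, ∑ b ∈ Finset.Ioi a, (c a b • m a b + c b a • m b a) := by
        rw [← Finset.sum_sum_Ioi_add_eq_sum_sum_off_diag fun a b => c b a • m b a]
    _ = ∑ a, ∑ b ∈ Finset.Ioi a, c a b • (m a b - m b a) :=
        Finset.sum_congr rfl fun a _ => Finset.sum_congr rfl fun b _ => by
          rw [hc a b, neg_smul, ← sub_eq_add_neg, ← smul_sub]

section

variable {ι : Type*} [Fintype ι] {ω : Matrix ι ι ℝ}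

theorem vecMul_dotProduct_of_skew (hω : ωᵀ = -ω) (x y : ι → ℝ) :
    (x ᵥ* ω) ⬝ᵥ y = -(x ⬝ᵥ (y ᵥ* ω)) := by
  rw [← dotProduct_mulVec, ← vecMul_transpose, hω, vecMul_neg, dotProduct_neg]

theorem dotProduct_mulVec_comm_of_skew (hω : ωᵀ = -ω) (x y : ι → ℝ) :
    y ⬝ᵥ (ω *ᵥ x) = -(x ⬝ᵥ (ω *ᵥ y)) := by
  rw [dotProduct_mulVec, vecMul_dotProduct_of_skew hω, dotProduct_comm, ← dotProduct_mulVec,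
    dotProduct_comm]

end

variable {n : ℕ}

theorem transpose_wedge (x y : Fin n → ℝ) : (wedge x y)ᵀ = -wedge x y := by
  rw [wedge, transpose_sub, transpose_vecMulVec, transpose_vecMulVec, neg_sub]

theorem vecMul_wedge (z x y : Fin n → ℝ) :
    z ᵥ* wedge x y = (z ⬝ᵥ x) • y - (z ⬝ᵥ y) • x := by
  rw [wedge, vecMul_sub, vecMul_vecMulVec, vecMul_vecMulVec]

theorem wedge_mulVec (x y z : Fin n → ℝ) :
    wedge x y *ᵥ z = (y ⬝ᵥ z) • x - (x ⬝ᵥ z) • y := by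
  rw [wedge, sub_mulVec, vecMulVec_mulVec, vecMulVec_mulVec, op_smul_eq_smul, op_smul_eq_smul]

theorem dotProduct_wedge_mulVec (x y z w : Fin n → ℝ) :
    z ⬝ᵥ (wedge x y *ᵥ w) = (z ⬝ᵥ x) * (y ⬝ᵥ w) - (z ⬝ᵥ y) * (x ⬝ᵥ w) := by
  simp only [wedge_mulVec, dotProduct_sub, dotProduct_smul, smul_eq_mul]
  ring

theorem killing_wedge_of_skew {ω : Matrix (Fin n) (Fin n) ℝ} (hω : ωᵀ = -ω)
    (x y : Fin n → ℝ) : killing ω (wedge x y) = x ⬝ᵥ (ω *ᵥ y) := by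
  simp only [killing, wedge, mul_sub, trace_sub, mul_vecMulVec, trace_vecMulVec]
  rw [dotProduct_comm (ω *ᵥ x), dotProduct_comm (ω *ᵥ y), dotProduct_mulVec_comm_of_skew hω]
  ring

theorem eq_sum_wedge_of_mulVec_zero {k : ℕ} {g B : Matrix (Fin (k + 1)) (Fin (k + 1)) ℝ}
    (hg : g * gᵀ = 1) (hB : Bᵀ = -B) (h0 : B *ᵥ g 0 = 0) :
    B = ∑ a : Fin k, ∑ b ∈ Finset.Ioi a,
      (g a.succ ⬝ᵥ (B *ᵥ g b.succ)) • wedge (g a.succ) (g b.succ) := by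
  have hskew : ∀ x y, y ⬝ᵥ (B *ᵥ x) = -(x ⬝ᵥ (B *ᵥ y)) := dotProduct_mulVec_comm_of_skew hB
  have h0' : ∀ x, g 0 ⬝ᵥ (B *ᵥ x) = 0 := fun x => by rw [hskew, h0, dotProduct_zero, neg_zero]
  nth_rw 1 [eq_sum_vecMulVec_row hg B]
  simp only [Fin.sum_univ_succ (n := k), h0, h0', dotProduct_zero, zero_smul, zero_add,
    Finset.sum_const_zero]
  exact sum_sum_smul_eq_sum_sum_Ioi (fun a b => hskew _ _) fun a b =>
    vecMulVec (g a.succ) (g b.succ)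

end Skew

section Transported

variable {ι : Type*} [Fintype ι] {I : Set ℝ}

theorem hasDerivAt_dotProduct {f g : ℝ → ι → ℝ} {f' g' : ι → ℝ} {t : ℝ}
    (hf : HasDerivAt f f' t) (hg : HasDerivAt g g' t) :
    HasDerivAt (fun s => f s ⬝ᵥ g s) (f' ⬝ᵥ g t + f t ⬝ᵥ g') t := by
  simp only [dotProduct, ← Finset.sum_add_distrib]
  exact HasDerivAt.fun_sum fun i _ => (hasDerivAt_pi.1 hf i).mul (hasDerivAt_pi.1 hg i)

theorem eq_of_hasDerivAt_zero (hI : IsOpen I) (hI' : I.OrdConnected) {f : ℝ → ℝ}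
    (hf : ∀ t ∈ I, HasDerivAt f 0 t) {s t : ℝ} (hs : s ∈ I) (ht : t ∈ I) : f s = f t :=
  hI.is_const_of_deriv_eq_zero hI'.isPreconnected
    (fun u hu => (hf u hu).differentiableAt.differentiableWithinAt)
    (fun u hu => (hf u hu).deriv) hs ht

theorem continuousOn_wedge {n : ℕ} {x y : ℝ → Fin n → ℝ} (hx : ContinuousOn x I)
    (hy : ContinuousOn y I) : ContinuousOn (fun t => wedge (x t) (y t)) I := by
  have h : Continuous fun z : (Fin n → ℝ) × (Fin n → ℝ) => wedge z.1 z.2 := by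
    unfold wedge
    fun_prop
  exact h.comp_continuousOn (hx.prodMk hy)

/-- The row vector `x` satisfies `ẋ = xω` over `I`. For skew-symmetric `ω` this is `ẋ = -ωx`, the
equation of the body coordinates `g⁻¹ E` of a vector `E` fixed in space, where `ω = g⁻¹ ġ`. -/
def IsTransported (I : Set ℝ) (ω : ℝ → Matrix ι ι ℝ) (x : ℝ → ι → ℝ) : Prop :=
  ∀ t ∈ I, HasDerivAt x (x t ᵥ* ω t) t

namespace IsTransported

variable {ω : ℝ → Matrix ι ι ℝ} {x y : ℝ → ι → ℝ}

theorem continuousOn (hx : IsTransported I ω x) : ContinuousOn x I :=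
  fun t ht => (hx t ht).continuousAt.continuousWithinAt

theorem congr (hx : IsTransported I ω x) (hI : IsOpen I) (h : Set.EqOn y x I) :
    IsTransported I ω y := fun t ht => by
  rw [h ht]
  exact (hx t ht).congr_of_eventuallyEq (h.eventuallyEq_of_mem (hI.mem_nhds ht))

theorem const_smul (hx : IsTransported I ω x) (c : ℝ) : IsTransported I ω fun t => c • x t :=
  fun t ht => by
    rw [smul_vecMul]
    exact (hx t ht).const_smul c

theorem sum {κ : Type*} [Fintype κ] {x : κ → ℝ → ι → ℝ} (hx : ∀ k, IsTransported I ω (x k)) :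
    IsTransported I ω fun t => ∑ k, x k t := fun t ht => by
  rw [sum_vecMul]
  exact HasDerivAt.fun_sum fun k _ => hx k t ht

theorem dotProduct_eq (hx : IsTransported I ω x) (hy : IsTransported I ω y) (hI : IsOpen I)
    (hI' : I.OrdConnected) (hω : ∀ t ∈ I, (ω t)ᵀ = -ω t) {s t : ℝ} (hs : s ∈ I) (ht : t ∈ I) :
    x s ⬝ᵥ y s = x t ⬝ᵥ y t := by
  refine eq_of_hasDerivAt_zero hI hI' (f := fun u => x u ⬝ᵥ y u) (fun u hu => ?_) hs ht
  refine (hasDerivAt_dotProduct (hx u hu) (hy u hu)).congr_deriv ?_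
  rw [vecMul_dotProduct_of_skew (hω u hu), neg_add_cancel]

end IsTransported

theorem exists_isTransported (hI : IsOpen I) (hI' : I.OrdConnected) {ω : ℝ → Matrix ι ι ℝ}
    (hω : ContinuousOn ω I) {t₀ : ℝ} (ht₀ : t₀ ∈ I) (x₀ : ι → ℝ) :
    ∃ x, x t₀ = x₀ ∧ IsTransported I ω x := by
  refine exists_hasDerivAt_of_continuousOn_clm hI hI'
    (L := fun t => LinearMap.toContinuousLinearMap (Matrix.vecMulLinear (ω t)))
    (continuousOn_clm_apply.2 fun v => ?_) ht₀ x₀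
  exact (continuous_const.matrix_vecMul continuous_id).comp_continuousOn hω

end Transported

section Diagonal

variable {ι : Type*} {A : ι → ℝ}

theorem inv_mul_mul_cancel (hA : ∀ i, A i ≠ 0) (x : ι → ℝ) : A⁻¹ * (A * x) = x :=
  funext fun i => inv_mul_cancel_left₀ (hA i) (x i)

variable [Fintype ι]

theorem mul_dotProduct_comm (A x y : ι → ℝ) : (A * x) ⬝ᵥ y = x ⬝ᵥ (A * y) :=
  Finset.sum_congr rfl fun i _ => by simp only [Pi.mul_apply]; ring

theorem dotProduct_mul_self_pos (hA : ∀ i, 0 < A i) {x : ι → ℝ} (hx : x ≠ 0) :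
    0 < x ⬝ᵥ (A * x) := by
  obtain ⟨i, hi⟩ := Function.ne_iff.1 hx
  have hterm : ∀ j, x j * (A * x) j = A j * x j ^ 2 := fun j => by rw [Pi.mul_apply]; ring
  refine Finset.sum_pos' (fun j _ => ?_) ⟨i, Finset.mem_univ i, ?_⟩
  · rw [hterm]
    exact mul_nonneg (hA j).le (sq_nonneg _)
  · rw [hterm]
    exact mul_pos (hA i) (sq_pos_of_ne_zero hi)

theorem dotProduct_self_pos {x : ι → ℝ} (hx : x ≠ 0) : 0 < x ⬝ᵥ x := by
  simpa using dotProduct_mul_self_pos (A := 1) (fun _ => one_pos) hx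

theorem ne_zero_of_dotProduct_self_eq_one {x : ι → ℝ} (hx : x ⬝ᵥ x = 1) : x ≠ 0 := by
  rintro rfl
  simp at hx

theorem sqrt_dotProduct_smul_self {c : ℝ} (hc : 0 ≤ c) (x : ι → ℝ) :
    √((c • x) ⬝ᵥ (c • x)) = c * √(x ⬝ᵥ x) := by
  rw [smul_dotProduct, dotProduct_smul, smul_eq_mul, smul_eq_mul, ← mul_assoc,
    Real.sqrt_mul (mul_self_nonneg c), Real.sqrt_mul_self hc]

theorem detA_pos {n : ℕ} {A : Fin n → ℝ} (hA : ∀ i, 0 < A i) : 0 < detA A :=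
  Finset.prod_pos fun i _ => hA i

end Diagonal

section Velocity

variable {n : ℕ} {A q p : Fin n → ℝ}

/-- The velocity `q̇` as a function of `q` and the momentum `p`: the right-hand side of the first
reduced equation. -/
def velocity (A q p : Fin n → ℝ) : Fin n → ℝ :=
  (detA A / (q ⬝ᵥ (A * q))) • (A⁻¹ * p - (p ⬝ᵥ (A⁻¹ * q)) • q)

theorem dotProduct_velocity_left (hq : q ⬝ᵥ q = 1) : q ⬝ᵥ velocity A q p = 0 := by
  rw [velocity, dotProduct_smul, dotProduct_sub, dotProduct_smul, hq, ← mul_dotProduct_comm A⁻¹,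
    dotProduct_comm p, smul_eq_mul, smul_eq_mul, mul_one, sub_self, mul_zero]

theorem dotProduct_velocity_right (hqp : q ⬝ᵥ p = 0) :
    p ⬝ᵥ velocity A q p = detA A / (q ⬝ᵥ (A * q)) * (p ⬝ᵥ (A⁻¹ * p)) := by
  rw [velocity, dotProduct_smul, dotProduct_sub, dotProduct_smul, dotProduct_comm p q, hqp,
    smul_zero, sub_zero, smul_eq_mul]

theorem velocity_dotProduct_mul (hA : ∀ i, 0 < A i) (hq : q ⬝ᵥ q = 1) (hqp : q ⬝ᵥ p = 0) :
    velocity A q p ⬝ᵥ (A * q) = -(detA A * (p ⬝ᵥ (A⁻¹ * q))) := by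
  have hσ := dotProduct_mul_self_pos hA (ne_zero_of_dotProduct_self_eq_one hq)
  rw [velocity, smul_dotProduct, sub_dotProduct, smul_dotProduct, mul_dotProduct_comm,
    inv_mul_mul_cancel fun i => (hA i).ne', dotProduct_comm p q, hqp]
  simp only [smul_eq_mul]
  field_simp
  ring

theorem momentum_velocity (hA : ∀ i, 0 < A i) (hq : q ⬝ᵥ q = 1) (hqp : q ⬝ᵥ p = 0) :
    momentum A q (velocity A q p) = p := by
  have hσ := dotProduct_mul_self_pos hA (ne_zero_of_dotProduct_self_eq_one hq)
  have hd := detA_pos hA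
  rw [momentum, velocity_dotProduct_mul hA hq hqp]
  ext i
  have hAi := (hA i).ne'
  simp only [velocity, Pi.smul_apply, Pi.sub_apply, Pi.mul_apply, Pi.inv_apply, smul_eq_mul]
  field_simp
  ring

theorem momentum_dotProduct (A q v : Fin n → ℝ) :
    momentum A q v ⬝ᵥ v = 2 * reducedLagrangian A q v := by
  simp only [momentum, reducedLagrangian, smul_dotProduct, sub_dotProduct, smul_eq_mul,
    dotProduct_comm v (A * q), dotProduct_comm q (A * q)]
  by_cases h : detA A = 0
  · simp [h]
  · field_simp

end Velocity

namespace IsReducedSolution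

variable {n : ℕ} {A : Fin n → ℝ} {I : Set ℝ} {q p : ℝ → Fin n → ℝ} {t : ℝ}

theorem deriv_q (h : IsReducedSolution A I q p) (ht : t ∈ I) :
    deriv q t = velocity A (q t) (p t) := (h.q_eq t ht).deriv

theorem hasDerivAt_q (h : IsReducedSolution A I q p) (ht : t ∈ I) :
    HasDerivAt q (deriv q t) t := (h.q_eq t ht).differentiableAt.hasDerivAt

theorem inner_pos (h : IsReducedSolution A I q p) (hA : ∀ i, 0 < A i) (ht : t ∈ I) :
    0 < q t ⬝ᵥ (A * q t) :=
  dotProduct_mul_self_pos hA (ne_zero_of_dotProduct_self_eq_one (h.sphere t ht))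

theorem momentum_deriv (h : IsReducedSolution A I q p) (hA : ∀ i, 0 < A i) (ht : t ∈ I) :
    momentum A (q t) (deriv q t) = p t := by
  rw [h.deriv_q ht, momentum_velocity hA (h.sphere t ht) (h.cotangent t ht)]

theorem dotProduct_deriv (h : IsReducedSolution A I q p) (ht : t ∈ I) :
    q t ⬝ᵥ deriv q t = 0 := by
  rw [h.deriv_q ht, dotProduct_velocity_left (h.sphere t ht)]

theorem hasDerivAt_p (h : IsReducedSolution A I q p) (ht : t ∈ I) :
    HasDerivAt p (-(p t ⬝ᵥ deriv q t) • q t) t := by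
  refine (h.p_eq t ht).congr_deriv ?_
  rw [h.deriv_q ht, dotProduct_velocity_right (h.cotangent t ht), dotProduct_comm (p t) (q t),
    h.cotangent t ht]
  congr 1
  ring

theorem differentiableAt_deriv_q (h : IsReducedSolution A I q p) (hA : ∀ i, 0 < A i)
    (hI : IsOpen I) (ht : t ∈ I) : DifferentiableAt ℝ (deriv q) t := by
  have hq := h.hasDerivAt_q ht
  have hp := h.hasDerivAt_p ht
  have hσ := (hasDerivAt_dotProduct hq (hq.const_mul A)).differentiableAt
  have hpq := (hasDerivAt_dotProduct hp (hq.const_mul A⁻¹)).differentiableAt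
  have hvel : DifferentiableAt ℝ (fun s => velocity A (q s) (p s)) t :=
    ((differentiableAt_const _).div hσ (h.inner_pos hA ht).ne').fun_smul
      ((hp.const_mul A⁻¹).differentiableAt.fun_sub (hpq.fun_smul hq.differentiableAt))
  refine hvel.congr_of_eventuallyEq ?_
  filter_upwards [hI.mem_nhds ht] with s hs using h.deriv_q hs

theorem hasDerivAt_inner (h : IsReducedSolution A I q p) (hA : ∀ i, 0 < A i) (ht : t ∈ I) :
    HasDerivAt (fun s => q s ⬝ᵥ (A * q s)) (-(2 * detA A * (p t ⬝ᵥ (A⁻¹ * q t)))) t := by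
  have hq := h.hasDerivAt_q ht
  refine (hasDerivAt_dotProduct hq (hq.const_mul A)).congr_deriv ?_
  rw [← mul_dotProduct_comm A (q t), dotProduct_comm (A * q t), h.deriv_q ht,
    velocity_dotProduct_mul hA (h.sphere t ht) (h.cotangent t ht)]
  ring

theorem isTransported_q (h : IsReducedSolution A I q p) :
    IsTransported I (fun t => wedge (q t) (deriv q t)) q := fun t ht => by
  simpa [vecMul_wedge, h.sphere t ht, h.dotProduct_deriv ht] using h.hasDerivAt_q ht

theorem isTransported_p (h : IsReducedSolution A I q p) :
    IsTransported I (fun t => wedge (q t) (deriv q t)) p := fun t ht => by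
  simpa [vecMul_wedge, dotProduct_comm (p t) (q t), h.cotangent t ht] using h.hasDerivAt_p ht

theorem continuousOn_omega (h : IsReducedSolution A I q p) (hA : ∀ i, 0 < A i) (hI : IsOpen I) :
    ContinuousOn (fun t => wedge (q t) (deriv q t)) I :=
  continuousOn_wedge h.isTransported_q.continuousOn fun _ ht =>
    (h.differentiableAt_deriv_q hA hI ht).continuousAt.continuousWithinAt

theorem dotProduct_p_self_eq (h : IsReducedSolution A I q p) (hI : IsOpen I)
    (hI' : I.OrdConnected) {s : ℝ} (hs : s ∈ I) (ht : t ∈ I) : p s ⬝ᵥ p s = p t ⬝ᵥ p t :=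
  h.isTransported_p.dotProduct_eq h.isTransported_p hI hI' (fun _ _ => transpose_wedge _ _) hs ht

theorem p_ne_zero (h : IsReducedSolution A I q p) (hI : IsOpen I) (hI' : I.OrdConnected)
    {t₀ : ℝ} (ht₀ : t₀ ∈ I) (hp : p t₀ ≠ 0) (ht : t ∈ I) : p t ≠ 0 := fun h0 =>
  hp (dotProduct_self_eq_zero.1 (by rw [h.dotProduct_p_self_eq hI hI' ht₀ ht, h0, zero_dotProduct]))

end IsReducedSolution

section Quadric

variable {n : ℕ} {A : Fin n → ℝ}

theorem quadricNormal_zero (A x : Fin n → ℝ) : quadricNormal A 0 x = -(A⁻¹ * x) := by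
  ext i
  rw [quadricNormal, zero_sub, div_neg, div_eq_inv_mul, Pi.neg_apply, Pi.mul_apply, Pi.inv_apply]

theorem sum_sq_div_eq_dotProduct (A : Fin n → ℝ) (α : ℝ) (x : Fin n → ℝ) :
    ∑ i, x i ^ 2 / (α - A i) = quadricNormal A α x ⬝ᵥ x :=
  Finset.sum_congr rfl fun i _ => by
    rw [quadricNormal, sq, mul_div_right_comm]

theorem mem_confocalQuadric_zero {x : Fin n → ℝ} :
    x ∈ confocalQuadric A 0 ↔ (A⁻¹ * x) ⬝ᵥ x = 1 := by
  rw [confocalQuadric, Set.mem_ofPred_eq, sum_sq_div_eq_dotProduct, quadricNormal_zero,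
    neg_dotProduct, neg_inj]

theorem inv_mul_geodesicCurve (hA : ∀ i, A i ≠ 0) (q : ℝ → Fin n → ℝ) (t : ℝ) :
    A⁻¹ * geodesicCurve A q t = (√(q t ⬝ᵥ (A * q t)))⁻¹ • q t := by
  rw [geodesicCurve, mul_smul_comm, inv_mul_mul_cancel hA]

end Quadric

namespace IsReducedSolution

variable {n : ℕ} {A : Fin n → ℝ} {I : Set ℝ} {q p : ℝ → Fin n → ℝ} {t : ℝ}

theorem sqrt_inner_pos (h : IsReducedSolution A I q p) (hA : ∀ i, 0 < A i) (ht : t ∈ I) :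
    0 < √(q t ⬝ᵥ (A * q t)) :=
  Real.sqrt_pos.2 (h.inner_pos hA ht)

theorem mul_eq_smul_geodesicCurve (h : IsReducedSolution A I q p) (hA : ∀ i, 0 < A i)
    (ht : t ∈ I) : A * q t = √(q t ⬝ᵥ (A * q t)) • geodesicCurve A q t := by
  rw [geodesicCurve, smul_inv_smul₀ (h.sqrt_inner_pos hA ht).ne']

theorem hasDerivAt_geodesicCurve (h : IsReducedSolution A I q p) (hA : ∀ i, 0 < A i)
    (ht : t ∈ I) : HasDerivAt (geodesicCurve A q)
      ((detA A * (√(q t ⬝ᵥ (A * q t)))⁻¹ ^ 3) • p t) t := by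
  have hr := (h.sqrt_inner_pos hA ht).ne'
  have hrr : √(q t ⬝ᵥ (A * q t)) * √(q t ⬝ᵥ (A * q t)) = q t ⬝ᵥ (A * q t) :=
    Real.mul_self_sqrt (h.inner_pos hA ht).le
  refine ((((h.hasDerivAt_inner hA ht).sqrt (h.inner_pos hA ht).ne').fun_inv hr).fun_smul
    ((h.hasDerivAt_q ht).const_mul A)).congr_deriv ?_
  rw [h.deriv_q ht]
  set r := √(q t ⬝ᵥ (A * q t))
  ext i
  have hAi := (hA i).ne'
  simp only [velocity, ← hrr, Pi.add_apply, Pi.smul_apply, Pi.sub_apply, Pi.mul_apply,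
    Pi.inv_apply, smul_eq_mul]
  field_simp
  ring

theorem detA_mul_inv_sqrt_pow_three_pos (h : IsReducedSolution A I q p) (hA : ∀ i, 0 < A i)
    (ht : t ∈ I) : 0 < detA A * (√(q t ⬝ᵥ (A * q t)))⁻¹ ^ 3 :=
  mul_pos (detA_pos hA) (pow_pos (inv_pos.2 (h.sqrt_inner_pos hA ht)) 3)

theorem gam_eq (h : IsReducedSolution A I q p) (hA : ∀ i, 0 < A i) (ht : t ∈ I) :
    gam A q t = (√(p t ⬝ᵥ p t))⁻¹ • p t := by
  have hc := h.detA_mul_inv_sqrt_pow_three_pos hA ht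
  rw [gam, unitTangent, (h.hasDerivAt_geodesicCurve hA ht).deriv, sqrt_dotProduct_smul_self hc.le,
    smul_smul, mul_inv, mul_right_comm, inv_mul_cancel₀ hc.ne', one_mul]

theorem isTransported_gam (h : IsReducedSolution A I q p) (hA : ∀ i, 0 < A i) (hI : IsOpen I)
    (hI' : I.OrdConnected) : IsTransported I (fun t => wedge (q t) (deriv q t)) (gam A q) :=
  fun t ht => ((h.isTransported_p.const_smul (√(p t ⬝ᵥ p t))⁻¹).congr hI fun s hs => by
    rw [h.gam_eq hA hs, h.dotProduct_p_self_eq hI hI' hs ht]) t ht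

theorem dotProduct_gam (h : IsReducedSolution A I q p) (hA : ∀ i, 0 < A i) (ht : t ∈ I) :
    q t ⬝ᵥ gam A q t = 0 := by
  rw [h.gam_eq hA ht, dotProduct_smul, h.cotangent t ht, smul_zero]

theorem dotProduct_gam_self (h : IsReducedSolution A I q p) (hA : ∀ i, 0 < A i) (ht : t ∈ I)
    (hp : p t ≠ 0) : gam A q t ⬝ᵥ gam A q t = 1 := by
  have hpp := dotProduct_self_pos hp
  rw [h.gam_eq hA ht, dotProduct_smul, smul_dotProduct, smul_eq_mul, smul_eq_mul, ← mul_assoc,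
    ← mul_inv, Real.mul_self_sqrt hpp.le, inv_mul_cancel₀ hpp.ne']

theorem geodesicCurve_mem (h : IsReducedSolution A I q p) (hA : ∀ i, 0 < A i) (ht : t ∈ I) :
    geodesicCurve A q t ∈ confocalQuadric A 0 := by
  rw [mem_confocalQuadric_zero, inv_mul_geodesicCurve fun i => (hA i).ne', smul_dotProduct,
    geodesicCurve, dotProduct_smul, smul_eq_mul, smul_eq_mul, ← mul_assoc, ← mul_inv,
    Real.mul_self_sqrt (h.inner_pos hA ht).le, inv_mul_cancel₀ (h.inner_pos hA ht).ne']

theorem isGeodesicOn (h : IsReducedSolution A I q p) (hA : ∀ i, 0 < A i) (hI : IsOpen I)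
    (hI' : I.OrdConnected) (hp : ∀ t ∈ I, p t ≠ 0) :
    IsGeodesicOn A 0 I (geodesicCurve A q) where
  mem _ ht := h.geodesicCurve_mem hA ht
  differentiable _ ht := (h.hasDerivAt_geodesicCurve hA ht).differentiableAt
  regular t ht := by
    rw [(h.hasDerivAt_geodesicCurve hA ht).deriv]
    exact smul_ne_zero (h.detA_mul_inv_sqrt_pow_three_pos hA ht).ne' (hp t ht)
  normal t ht := by
    refine ⟨(gam A q t ⬝ᵥ deriv q t) * √(q t ⬝ᵥ (A * q t)),
      (h.isTransported_gam hA hI hI' t ht).congr_deriv ?_⟩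
    rw [vecMul_wedge, dotProduct_comm, h.dotProduct_gam hA ht, quadricNormal_zero,
      inv_mul_geodesicCurve fun i => (hA i).ne', mul_smul, smul_neg,
      smul_inv_smul₀ (h.sqrt_inner_pos hA ht).ne', zero_smul, zero_sub, smul_neg]

theorem reducedLagrangian_eq (h : IsReducedSolution A I q p) (hA : ∀ i, 0 < A i) (ht : t ∈ I) :
    reducedLagrangian A (q t) (deriv q t) =
      detA A * (p t ⬝ᵥ (A⁻¹ * p t)) / (2 * (q t ⬝ᵥ (A * q t))) := by
  have hpv := momentum_dotProduct A (q t) (deriv q t)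
  rw [h.momentum_deriv hA ht] at hpv
  nth_rw 1 [h.deriv_q ht] at hpv
  rw [dotProduct_velocity_right (h.cotangent t ht)] at hpv
  rw [mul_comm 2, ← div_div, mul_div_right_comm, hpv]
  ring

theorem reducedLagrangian_const (h : IsReducedSolution A I q p) (hA : ∀ i, 0 < A i)
    (hI : IsOpen I) (hI' : I.OrdConnected) {s : ℝ} (hs : s ∈ I) (ht : t ∈ I) :
    reducedLagrangian A (q s) (deriv q s) = reducedLagrangian A (q t) (deriv q t) := by
  rw [h.reducedLagrangian_eq hA hs, h.reducedLagrangian_eq hA ht]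
  refine eq_of_hasDerivAt_zero hI hI'
    (f := fun s => detA A * (p s ⬝ᵥ (A⁻¹ * p s)) / (2 * (q s ⬝ᵥ (A * q s)))) (fun u hu => ?_) hs ht
  have hσ := (h.inner_pos hA hu).ne'
  have hp := h.hasDerivAt_p hu
  refine (((hasDerivAt_dotProduct hp (hp.const_mul A⁻¹)).const_mul (detA A)).fun_div
    ((h.hasDerivAt_inner hA hu).const_mul 2) (by positivity)).congr_deriv ?_
  rw [← mul_dotProduct_comm _ (p u), dotProduct_smul, smul_dotProduct, h.deriv_q hu,
    dotProduct_velocity_right (h.cotangent u hu), mul_dotProduct_comm A⁻¹ (p u),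
    dotProduct_comm (q u) (A⁻¹ * p u), mul_dotProduct_comm A⁻¹ (p u)]
  simp only [smul_eq_mul]
  field_simp
  ring

theorem geodesicCurve_dotProduct_inv_sq (h : IsReducedSolution A I q p) (hA : ∀ i, 0 < A i)
    (ht : t ∈ I) :
    geodesicCurve A q t ⬝ᵥ (A⁻¹ ^ 2 * geodesicCurve A q t) = (q t ⬝ᵥ (A * q t))⁻¹ := by
  rw [pow_two, mul_assoc, ← mul_dotProduct_comm, inv_mul_geodesicCurve fun i => (hA i).ne',
    smul_dotProduct, dotProduct_smul, h.sphere t ht, smul_eq_mul, smul_eq_mul, mul_one, ← mul_inv,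
    Real.mul_self_sqrt (h.inner_pos hA ht).le]

theorem gam_dotProduct_inv (h : IsReducedSolution A I q p) (hA : ∀ i, 0 < A i) (ht : t ∈ I) :
    gam A q t ⬝ᵥ (A⁻¹ * gam A q t) = (p t ⬝ᵥ (A⁻¹ * p t)) / (p t ⬝ᵥ p t) := by
  have hpp : 0 ≤ p t ⬝ᵥ p t := Finset.sum_nonneg fun i _ => mul_self_nonneg (p t i)
  rw [h.gam_eq hA ht, mul_smul_comm, dotProduct_smul, smul_dotProduct, smul_eq_mul, smul_eq_mul,
    ← mul_assoc, ← mul_inv, Real.mul_self_sqrt hpp, div_eq_inv_mul]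

theorem geodesicSpeed_eq (h : IsReducedSolution A I q p) (hA : ∀ i, 0 < A i) (ht : t ∈ I)
    (hp : p t ≠ 0) :
    √(deriv (geodesicCurve A q) t ⬝ᵥ deriv (geodesicCurve A q) t) =
      √((geodesicCurve A q t ⬝ᵥ (A⁻¹ ^ 2 * geodesicCurve A q t)) /
        (gam A q t ⬝ᵥ (A⁻¹ * gam A q t))) *
      √(detA A * (2 * reducedLagrangian A (q t) (deriv q t) / ((A * q t) ⬝ᵥ q t))) := by
  have hσ := h.inner_pos hA ht
  have hr := h.sqrt_inner_pos hA ht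
  have hd := detA_pos hA
  have hpp := dotProduct_self_pos hp
  have hpA := dotProduct_mul_self_pos (A := A⁻¹) (fun i => inv_pos.2 (hA i)) hp
  have hrr := Real.mul_self_sqrt hσ.le
  have hc := h.detA_mul_inv_sqrt_pow_three_pos hA ht
  rw [(h.hasDerivAt_geodesicCurve hA ht).deriv, h.geodesicCurve_dotProduct_inv_sq hA ht,
    h.gam_dotProduct_inv hA ht, h.reducedLagrangian_eq hA ht, mul_dotProduct_comm A (q t),
    sqrt_dotProduct_smul_self hc.le, ← Real.sqrt_mul (by positivity), eq_comm,
    Real.sqrt_eq_iff_mul_self_eq (by positivity) (by positivity), ← mul_mul_mul_comm,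
    Real.mul_self_sqrt hpp.le]
  set r := √(q t ⬝ᵥ (A * q t))
  rw [← hrr]
  field_simp

theorem exists_energy (h : IsReducedSolution A I q p) (hA : ∀ i, 0 < A i) (hI : IsOpen I)
    (hI' : I.OrdConnected) (hp : ∀ t ∈ I, p t ≠ 0) {t₀ : ℝ} (ht₀ : t₀ ∈ I) :
    ∃ E : ℝ, 0 < E ∧ ∀ t ∈ I, reducedLagrangian A (q t) (deriv q t) = E ∧
      √(deriv (geodesicCurve A q) t ⬝ᵥ deriv (geodesicCurve A q) t) =
        √((geodesicCurve A q t ⬝ᵥ (A⁻¹ ^ 2 * geodesicCurve A q t)) /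
          (gam A q t ⬝ᵥ (A⁻¹ * gam A q t))) *
        √(detA A * (2 * E / ((A * q t) ⬝ᵥ q t))) := by
  refine ⟨reducedLagrangian A (q t₀) (deriv q t₀), ?_, fun t ht =>
    ⟨h.reducedLagrangian_const hA hI hI' ht ht₀, ?_⟩⟩
  · have hpA := dotProduct_mul_self_pos (A := A⁻¹) (fun i => inv_pos.2 (hA i)) (hp t₀ ht₀)
    rw [h.reducedLagrangian_eq hA ht₀]
    exact div_pos (mul_pos (detA_pos hA) hpA) (mul_pos two_pos (h.inner_pos hA ht₀))
  · rw [h.geodesicSpeed_eq hA ht (hp t ht), h.reducedLagrangian_const hA hI hI' ht ht₀]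

end IsReducedSolution

section Inertia

variable {n : ℕ} (A : Fin n → ℝ)

theorem transpose_inertia_of_skew {ω : Matrix (Fin n) (Fin n) ℝ} (hω : ωᵀ = -ω) :
    (inertia A ω)ᵀ = -inertia A ω := by
  ext i j
  have hij : ω j i = -ω i j := congrFun (congrFun hω i) j
  simp only [inertia, transpose_apply, of_apply, Matrix.neg_apply, hij]
  ring

theorem inertia_wedge (x y : Fin n → ℝ) :
    inertia A (wedge x y) = (1 / detA A) • wedge (A * x) (A * y) := by
  ext i j
  simp only [inertia, wedge, of_apply, Matrix.smul_apply, Matrix.sub_apply, vecMulVec_apply,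
    smul_eq_mul, Pi.mul_apply]
  ring

theorem inertia_wedge_mulVec (q v : Fin n → ℝ) :
    inertia A (wedge q v) *ᵥ q = -momentum A q v := by
  rw [inertia_wedge, smul_mulVec, wedge_mulVec, momentum, ← smul_neg, neg_sub,
    mul_dotProduct_comm A v, dotProduct_comm (A * q)]

/-- The term `d/dt (𝓘 ω) - [𝓘 ω, ω]` for `ω = q ∧ q̇`, as a function of `q`, `v = q̇` and `a = q̈`;
the multipliers of the LR system have to produce it. -/
def reaction (q v a : Fin n → ℝ) : Matrix (Fin n) (Fin n) ℝ :=
  inertia A (wedge q a) -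
    (inertia A (wedge q v) * wedge q v - wedge q v * inertia A (wedge q v))

theorem transpose_reaction (q v a : Fin n → ℝ) : (reaction A q v a)ᵀ = -reaction A q v a := by
  simp only [reaction, transpose_sub, transpose_mul, transpose_wedge,
    transpose_inertia_of_skew A (transpose_wedge _ _), Matrix.neg_mul, Matrix.mul_neg, neg_neg]
  abel

variable {q : ℝ → Fin n → ℝ} {t : ℝ}

theorem hasDerivAt_inertia_wedge_deriv (hq : HasDerivAt q (deriv q t) t)
    (hq' : HasDerivAt (deriv q) (deriv (deriv q) t) t) (i j : Fin n) :
    HasDerivAt (fun u => inertia A (wedge (q u) (deriv q u)) i j)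
      (inertia A (wedge (q t) (deriv (deriv q) t)) i j) t := by
  simp only [inertia, of_apply, wedge, Matrix.sub_apply, vecMulVec_apply]
  refine ((((hasDerivAt_pi.1 hq i).mul (hasDerivAt_pi.1 hq' j)).fun_sub
    ((hasDerivAt_pi.1 hq' i).mul (hasDerivAt_pi.1 hq j))).const_mul _).congr_deriv ?_
  ring

end Inertia

namespace IsReducedSolution

variable {n : ℕ} {A : Fin n → ℝ} {I : Set ℝ} {q p : ℝ → Fin n → ℝ} {t : ℝ}

theorem inertia_omega_mulVec (h : IsReducedSolution A I q p) (hA : ∀ i, 0 < A i) (ht : t ∈ I) :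
    inertia A (wedge (q t) (deriv q t)) *ᵥ q t = -p t := by
  rw [inertia_wedge_mulVec, h.momentum_deriv hA ht]

theorem reaction_mulVec (h : IsReducedSolution A I q p) (hA : ∀ i, 0 < A i) (hI : IsOpen I)
    (ht : t ∈ I) : reaction A (q t) (deriv q t) (deriv (deriv q) t) *ᵥ q t = 0 := by
  -- Differentiate `𝓘(ω) q = -p`.
  have hq := h.hasDerivAt_q ht
  have hleft : HasDerivAt (fun u => inertia A (wedge (q u) (deriv q u)) *ᵥ q u)
      (inertia A (wedge (q t) (deriv (deriv q) t)) *ᵥ q t +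
        inertia A (wedge (q t) (deriv q t)) *ᵥ deriv q t) t :=
    hasDerivAt_pi.2 fun i =>
      hasDerivAt_dotProduct (f := fun u => inertia A (wedge (q u) (deriv q u)) i)
        (hasDerivAt_pi.2 (hasDerivAt_inertia_wedge_deriv A hq
          (h.differentiableAt_deriv_q hA hI ht).hasDerivAt i)) hq
  have hright : HasDerivAt (fun u => inertia A (wedge (q u) (deriv q u)) *ᵥ q u)
      (-(-(p t ⬝ᵥ deriv q t) • q t)) t := by
    refine (h.hasDerivAt_p ht).fun_neg.congr_of_eventuallyEq ?_
    filter_upwards [hI.mem_nhds ht] with s hs using h.inertia_omega_mulVec hA hs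
  rw [reaction, sub_mulVec, sub_mulVec, ← mulVec_mulVec, ← mulVec_mulVec,
    h.inertia_omega_mulVec hA ht, eq_sub_of_add_eq (hleft.unique hright), wedge_mulVec, mulVec_neg,
    wedge_mulVec, h.sphere t ht, h.cotangent t ht, dotProduct_comm (deriv q t) (q t),
    h.dotProduct_deriv ht, dotProduct_comm (deriv q t) (p t)]
  simp only [mulVec_neg, zero_smul, zero_sub, one_smul, neg_smul, sub_zero, neg_neg]
  abel

end IsReducedSolution

theorem mem_SO_iff {ι : Type*} [Fintype ι] [DecidableEq ι] {g : Matrix ι ι ℝ} :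
    g ∈ specialOrthogonalGroup ι ℝ ↔ g * gᵀ = 1 ∧ g.det = 1 := by
  rw [mem_specialOrthogonalGroup_iff, mem_orthogonalGroup_iff]

namespace IsLRSolution

variable {k : ℕ} {A : Fin (k + 1) → ℝ} {I : Set ℝ}
  {g ω : ℝ → Matrix (Fin (k + 1)) (Fin (k + 1)) ℝ} {t : ℝ}

theorem isTransported (h : IsLRSolution A I g ω) (i : Fin (k + 1)) :
    IsTransported I ω fun t => g t i :=
  fun t ht => hasDerivAt_pi.2 fun j => h.kinematic t ht i j

theorem mul_transpose (h : IsLRSolution A I g ω) (ht : t ∈ I) : g t * (g t)ᵀ = 1 :=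
  (mem_SO_iff.1 (h.mem_SO t ht)).1

theorem transpose_omega (h : IsLRSolution A I g ω) (hI : IsOpen I) (ht : t ∈ I) :
    (ω t)ᵀ = -ω t := by
  refine ext_of_forall_dotProduct_mulVec_row (h.mul_transpose ht) fun i j => ?_
  have hconst : HasDerivAt (fun s => g s i ⬝ᵥ g s j) 0 t := by
    refine (hasDerivAt_const t (if i = j then (1 : ℝ) else 0)).congr_of_eventuallyEq ?_
    filter_upwards [hI.mem_nhds ht] with s hs using dotProduct_row_eq_ite (h.mul_transpose hs) i j
  have hzero := (hasDerivAt_dotProduct (h.isTransported i t ht) (h.isTransported j t ht)).unique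
    hconst
  rw [mulVec_transpose, neg_mulVec, dotProduct_neg, dotProduct_mulVec]
  exact eq_neg_of_add_eq_zero_right hzero

theorem dotProduct_omega_mulVec_succ (h : IsLRSolution A I g ω) (hI : IsOpen I) (ht : t ∈ I)
    (a b : Fin k) : g t a.succ ⬝ᵥ (ω t *ᵥ g t b.succ) = 0 := by
  have hω := h.transpose_omega hI ht
  have hlt : ∀ a b : Fin k, a < b → g t a.succ ⬝ᵥ (ω t *ᵥ g t b.succ) = 0 := fun a b hab => by
    rw [← killing_wedge_of_skew hω, h.constraint t ht a b hab]
  rcases lt_trichotomy a b with hab | rfl | hab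
  · exact hlt a b hab
  · exact self_eq_neg.1 (dotProduct_mulVec_comm_of_skew hω _ _)
  · rw [dotProduct_mulVec_comm_of_skew hω, hlt b a hab, neg_zero]

theorem omega_eq (h : IsLRSolution A I g ω) (hI : IsOpen I) (ht : t ∈ I) :
    ω t = wedge (g t 0) (g t 0 ᵥ* ω t) := by
  have hω := h.transpose_omega hI ht
  have hg := dotProduct_row_eq_ite (h.mul_transpose ht)
  refine ext_of_forall_dotProduct_mulVec_row (h.mul_transpose ht) fun i j => ?_
  rw [dotProduct_wedge_mulVec, hg, hg, dotProduct_comm (g t i) (g t 0 ᵥ* ω t),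
    ← dotProduct_mulVec, ← dotProduct_mulVec]
  cases i using Fin.cases with
  | zero =>
    have h00 : g t 0 ⬝ᵥ (ω t *ᵥ g t 0) = 0 :=
      self_eq_neg.1 (dotProduct_mulVec_comm_of_skew hω _ _)
    simp [h00]
  | succ a =>
    cases j using Fin.cases with
    | zero =>
      rw [if_pos rfl, if_neg (Fin.succ_ne_zero a), dotProduct_mulVec_comm_of_skew hω (g t 0)]
      ring
    | succ b =>
      simp [Fin.succ_ne_zero a, (Fin.succ_ne_zero b).symm, h.dotProduct_omega_mulVec_succ hI ht]

theorem omega_eq_wedge_deriv (h : IsLRSolution A I g ω) (hI : IsOpen I)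
    {q : ℝ → Fin (k + 1) → ℝ} (hq : ∀ t ∈ I, g t 0 = q t) (ht : t ∈ I) :
    ω t = wedge (q t) (deriv q t) := by
  have hq' := (h.isTransported 0).congr hI fun s hs => (hq s hs).symm
  rw [(hq' t ht).deriv, ← hq t ht]
  exact h.omega_eq hI ht

theorem congr (h : IsLRSolution A I g ω) (hI : IsOpen I)
    {ω' : ℝ → Matrix (Fin (k + 1)) (Fin (k + 1)) ℝ} (hω : Set.EqOn ω' ω I) :
    IsLRSolution A I g ω' where
  mem_SO := h.mem_SO
  kinematic t ht i j := by
    rw [hω ht]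
    exact h.kinematic t ht i j
  constraint t ht a b hab := by
    rw [hω ht]
    exact h.constraint t ht a b hab
  dynamic t ht := by
    obtain ⟨lam, hlam⟩ := h.dynamic t ht
    refine ⟨lam, fun i j => ?_⟩
    rw [hω ht]
    refine (hlam i j).congr_of_eventuallyEq ?_
    filter_upwards [hI.mem_nhds ht] with s hs
    rw [hω hs]

end IsLRSolution

namespace IsReducedSolution

variable {k : ℕ} {A : Fin (k + 1) → ℝ} {I : Set ℝ} {q p : ℝ → Fin (k + 1) → ℝ}
  {g : ℝ → Matrix (Fin (k + 1)) (Fin (k + 1)) ℝ}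

theorem isLRSolution_iff (h : IsReducedSolution A I q p) (hA : ∀ i, 0 < A i) (hI : IsOpen I)
    (hg0 : ∀ t ∈ I, g t 0 = q t) :
    IsLRSolution A I g (fun t => wedge (q t) (deriv q t)) ↔
      (∀ t ∈ I, g t ∈ specialOrthogonalGroup (Fin (k + 1)) ℝ) ∧
        ∀ i, IsTransported I (fun t => wedge (q t) (deriv q t)) fun t => g t i := by
  refine ⟨fun hg => ⟨hg.mem_SO, hg.isTransported⟩, fun ⟨hSO, htr⟩ => ⟨hSO, fun t ht i j =>
    hasDerivAt_pi.1 (htr i t ht) j, fun t ht a b _ => ?_, fun t ht => ?_⟩⟩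
  · have hg := dotProduct_row_eq_ite (mem_SO_iff.1 (hSO t ht)).1
    rw [killing_wedge_of_skew (transpose_wedge _ _), dotProduct_wedge_mulVec, ← hg0 t ht, hg, hg,
      if_neg (Fin.succ_ne_zero a), if_neg (Fin.succ_ne_zero b).symm, zero_mul, mul_zero, sub_zero]
  · let B := reaction A (q t) (deriv q t) (deriv (deriv q) t)
    have hB0 : B *ᵥ g t 0 = 0 := by rw [hg0 t ht, h.reaction_mulVec hA hI ht]
    refine ⟨fun a b => g t a.succ ⬝ᵥ (B *ᵥ g t b.succ), fun i j =>
      (hasDerivAt_inertia_wedge_deriv A (h.hasDerivAt_q ht)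
        (h.differentiableAt_deriv_q hA hI ht).hasDerivAt i j).congr_deriv ?_⟩
    rw [← eq_sum_wedge_of_mulVec_zero (mem_SO_iff.1 (hSO t ht)).1 (transpose_reaction A _ _ _) hB0,
      reaction, add_sub_cancel]

theorem isLRSolution_and_projectsTo_iff_isTransported (h : IsReducedSolution A I q p)
    (hA : ∀ i, 0 < A i) (hI : IsOpen I) (ω : ℝ → Matrix (Fin (k + 1)) (Fin (k + 1)) ℝ) :
    IsLRSolution A I g ω ∧ ProjectsTo A I g ω q p ↔
      (∀ t ∈ I, ω t = wedge (q t) (deriv q t) ∧ g t 0 = q t) ∧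
        (∀ t ∈ I, g t ∈ specialOrthogonalGroup (Fin (k + 1)) ℝ) ∧
          ∀ i, IsTransported I (fun t => wedge (q t) (deriv q t)) fun t => g t i := by
  constructor
  · rintro ⟨hg, hproj⟩
    have hg0 : ∀ t ∈ I, g t 0 = q t := fun t ht => (hproj t ht).1
    have hω : Set.EqOn ω (fun t => wedge (q t) (deriv q t)) I := fun t ht =>
      hg.omega_eq_wedge_deriv hI hg0 ht
    exact ⟨fun t ht => ⟨hω ht, hg0 t ht⟩, (h.isLRSolution_iff hA hI hg0).1 (hg.congr hI hω.symm)⟩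
  · rintro ⟨hωq, hg⟩
    refine ⟨((h.isLRSolution_iff hA hI fun t ht => (hωq t ht).2).2 hg).congr hI fun t ht =>
      (hωq t ht).1, fun t ht => ⟨(hωq t ht).2, ?_⟩⟩
    rw [(hωq t ht).1, (hωq t ht).2, wedge_mulVec, dotProduct_comm (deriv q t),
      h.dotProduct_deriv ht, h.sphere t ht, zero_smul, one_smul, zero_sub, neg_neg,
      h.momentum_deriv hA ht]

end IsReducedSolution

section LaxMatrix

variable {n : ℕ} {A x v : Fin n → ℝ} {α w : ℝ}

theorem orthProj_mulVec (hv : v ⬝ᵥ v = 1) (y : Fin n → ℝ) :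
    orthProj v *ᵥ y = y - (v ⬝ᵥ y) • v := by
  ext i
  simp [orthProj, sub_mulVec, hv, vecMulVec_mulVec]

theorem transpose_orthProj (v : Fin n → ℝ) : (orthProj v)ᵀ = orthProj v := by
  simp [orthProj, transpose_sub, transpose_smul, transpose_vecMulVec]

theorem transpose_laxMatrix (A x v : Fin n → ℝ) : (laxMatrix A x v)ᵀ = laxMatrix A x v := by
  simp [laxMatrix, transpose_mul, transpose_orthProj, transpose_sub, transpose_vecMulVec,
    Matrix.mul_assoc]

theorem laxMatrix_mulVec_self (A x : Fin n → ℝ) (hv : v ⬝ᵥ v = 1) :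
    laxMatrix A x v *ᵥ v = 0 := by
  rw [laxMatrix, ← mulVec_mulVec, orthProj_mulVec hv v, hv, one_smul, sub_self, mulVec_zero]

theorem laxMatrix_mulVec (A x : Fin n → ℝ) (hv : v ⬝ᵥ v = 1) {y : Fin n → ℝ} (hy : v ⬝ᵥ y = 0) :
    laxMatrix A x v *ᵥ y =
      (A * y - (x ⬝ᵥ y) • x) - (v ⬝ᵥ (A * y - (x ⬝ᵥ y) • x)) • v := by
  have hd : diagonal A *ᵥ y = A * y := funext fun i => mulVec_diagonal _ _ _
  have hx : vecMulVec x x *ᵥ y = (x ⬝ᵥ y) • x := by rw [vecMulVec_mulVec, op_smul_eq_smul]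
  rw [laxMatrix, ← mulVec_mulVec, ← mulVec_mulVec, orthProj_mulVec hv y, hy, zero_smul, sub_zero,
    sub_mulVec, hd, hx, orthProj_mulVec hv]

theorem dotProduct_laxMatrix_mulVec (A x : Fin n → ℝ) (hv : v ⬝ᵥ v = 1) {y z : Fin n → ℝ}
    (hy : v ⬝ᵥ y = 0) (hz : v ⬝ᵥ z = 0) :
    y ⬝ᵥ (laxMatrix A x v *ᵥ z) = y ⬝ᵥ (A * z) - (x ⬝ᵥ y) * (x ⬝ᵥ z) := by
  rw [laxMatrix_mulVec A x hv hz, dotProduct_sub, dotProduct_sub, dotProduct_smul,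
    dotProduct_smul, dotProduct_comm y v, hy, dotProduct_comm y x, smul_zero, sub_zero, smul_eq_mul,
    mul_comm (x ⬝ᵥ z)]

/- The eigenvalue equation says `(α - A) y = -z` with `z = (x, y) x + μ v`, so `y` is, up to sign,
the normal of `Q(α)` at the point `[z : (x, y)]` of the line. -/
theorem exists_touchesAt_of_laxMatrix_mulVec (hα : ∀ i, α ≠ A i) (hv : v ⬝ᵥ v = 1)
    {y : Fin n → ℝ} (hy : y ≠ 0) (hvy : v ⬝ᵥ y = 0) (h : laxMatrix A x v *ᵥ y = α • y) :
    ∃ z w, TouchesAt A α x v z w := by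
  rw [laxMatrix_mulVec A x hv hvy] at h
  set μ := v ⬝ᵥ (A * y - (x ⬝ᵥ y) • x)
  set z := (x ⬝ᵥ y) • x + μ • v with hz
  have hzi : ∀ i, z i = -(y i * (α - A i)) := fun i => by
    have := congrFun h i
    simp only [Pi.sub_apply, Pi.mul_apply, Pi.smul_apply, smul_eq_mul] at this
    simp only [hz, Pi.add_apply, Pi.smul_apply, smul_eq_mul]
    linarith
  have hN : quadricNormal A α z = -y := by
    ext i
    rw [quadricNormal, hzi, neg_div, mul_div_cancel_right₀ _ (sub_ne_zero.2 (hα i)), Pi.neg_apply]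
  refine ⟨z, x ⬝ᵥ y, fun h0 => hy ?_, ⟨μ, rfl⟩, ?_, ?_, ?_⟩
  · rw [← neg_eq_zero, ← hN, h0]
    exact funext fun i => zero_div _
  · rw [sum_sq_div_eq_dotProduct, hN, hz, neg_dotProduct, dotProduct_add, dotProduct_smul,
      dotProduct_smul, dotProduct_comm y v, hvy, dotProduct_comm y x]
    simp only [smul_eq_mul]
    ring
  · rw [hN, neg_dotProduct, dotProduct_comm, hvy, neg_zero]
  · rw [hN, neg_dotProduct, dotProduct_comm, neg_add_cancel]

theorem TouchesAt.laxMatrix_mulVec_quadricNormal (hα : ∀ i, α ≠ A i) (hv : v ⬝ᵥ v = 1)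
    {z : Fin n → ℝ} (h : TouchesAt A α x v z w) :
    laxMatrix A x v *ᵥ quadricNormal A α z = α • quadricNormal A α z := by
  obtain ⟨-, ⟨σ, hσ⟩, -, hNv, hNx⟩ := h
  have hxN : x ⬝ᵥ quadricNormal A α z = -w := by
    rw [dotProduct_comm, eq_neg_of_add_eq_zero_left hNx]
  have hvN : v ⬝ᵥ quadricNormal A α z = 0 := by rw [dotProduct_comm, hNv]
  have hAN : A * quadricNormal A α z - (-w) • x = α • quadricNormal A α z - σ • v := by
    ext i
    have hzi : z i = w * x i + σ * v i := by rw [hσ]; rfl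
    have hNi : (α - A i) * quadricNormal A α z i = z i :=
      mul_div_cancel₀ _ (sub_ne_zero.2 (hα i))
    simp only [Pi.sub_apply, Pi.mul_apply, Pi.smul_apply, smul_eq_mul]
    linarith
  rw [laxMatrix_mulVec A x hv hvN, hxN, hAN, dotProduct_sub, dotProduct_smul, dotProduct_smul, hvN,
    hv, smul_zero, zero_sub, smul_eq_mul, mul_one, neg_smul, sub_neg_eq_add, sub_add_cancel]

theorem TouchesAt.quadricNormal_ne_zero (hα : ∀ i, α ≠ A i) {z : Fin n → ℝ}
    (h : TouchesAt A α x v z w) : quadricNormal A α z ≠ 0 := fun h0 =>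
  h.1 <| funext fun i =>
    (div_eq_zero_iff.1 (congrFun h0 i)).resolve_right (sub_ne_zero.2 (hα i))

end LaxMatrix

theorem transpose_laxCurve {n : ℕ} (A : Fin n → ℝ) (q : ℝ → Fin n → ℝ) (t : ℝ) :
    (laxCurve A q t)ᵀ = laxCurve A q t :=
  transpose_laxMatrix _ _ _

theorem IsTransported.hasDerivAt_of_dotProduct_eq_zero {n : ℕ} {I : Set ℝ}
    {q e : ℝ → Fin n → ℝ} {t : ℝ} (he : IsTransported I (fun t => wedge (q t) (deriv q t)) e)
    (ht : t ∈ I) (hqe : q t ⬝ᵥ e t = 0) : HasDerivAt e (-(e t ⬝ᵥ deriv q t) • q t) t := by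
  refine (he t ht).congr_deriv ?_
  rw [vecMul_wedge, dotProduct_comm (e t) (q t), hqe, zero_smul, zero_sub, neg_smul]

namespace IsReducedSolution

variable {n : ℕ} {A : Fin n → ℝ} {I : Set ℝ} {q p : ℝ → Fin n → ℝ} {t : ℝ}

theorem dotProduct_mul_eq (h : IsReducedSolution A I q p) (hA : ∀ i, 0 < A i) (ht : t ∈ I)
    (e : Fin n → ℝ) :
    q t ⬝ᵥ (A * e) = √(q t ⬝ᵥ (A * q t)) * (geodesicCurve A q t ⬝ᵥ e) := by
  conv_lhs => rw [← mul_dotProduct_comm, h.mul_eq_smul_geodesicCurve hA ht, smul_dotProduct]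
  rfl

theorem geodesicCurve_dotProduct_q (h : IsReducedSolution A I q p) (hA : ∀ i, 0 < A i)
    (ht : t ∈ I) : geodesicCurve A q t ⬝ᵥ q t = √(q t ⬝ᵥ (A * q t)) := by
  refine mul_left_cancel₀ (h.sqrt_inner_pos hA ht).ne' ?_
  rw [← h.dotProduct_mul_eq hA ht, Real.mul_self_sqrt (h.inner_pos hA ht).le]

theorem laxCurve_mulVec_gam (h : IsReducedSolution A I q p) (hA : ∀ i, 0 < A i) (ht : t ∈ I)
    (hp : p t ≠ 0) : laxCurve A q t *ᵥ gam A q t = 0 :=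
  laxMatrix_mulVec_self _ _ (h.dotProduct_gam_self hA ht hp)

theorem laxCurve_mulVec_q (h : IsReducedSolution A I q p) (hA : ∀ i, 0 < A i) (ht : t ∈ I)
    (hp : p t ≠ 0) : laxCurve A q t *ᵥ q t = 0 := by
  have hγq : gam A q t ⬝ᵥ q t = 0 := by rw [dotProduct_comm, h.dotProduct_gam hA ht]
  rw [laxCurve, laxMatrix_mulVec _ _ (h.dotProduct_gam_self hA ht hp) hγq,
    h.geodesicCurve_dotProduct_q hA ht, ← h.mul_eq_smul_geodesicCurve hA ht, sub_self,
    dotProduct_zero, zero_smul, sub_zero]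

-- `(e, 𝓛 e)` is the minimum over `c` of the positive quantity `(e - c q, A (e - c q))`.
theorem dotProduct_laxCurve_mulVec_pos (h : IsReducedSolution A I q p) (hA : ∀ i, 0 < A i)
    (ht : t ∈ I) (hp : p t ≠ 0) {e : Fin n → ℝ} (he : e ≠ 0) (hqe : q t ⬝ᵥ e = 0)
    (hγe : gam A q t ⬝ᵥ e = 0) : 0 < e ⬝ᵥ (laxCurve A q t *ᵥ e) := by
  obtain ⟨r, hr, hqq⟩ : ∃ r, geodesicCurve A q t ⬝ᵥ q t = r ∧ q t ⬝ᵥ (A * q t) = r * r :=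
    ⟨_, h.geodesicCurve_dotProduct_q hA ht, (Real.mul_self_sqrt (h.inner_pos hA ht).le).symm⟩
  obtain ⟨c, hc⟩ : ∃ c, geodesicCurve A q t ⬝ᵥ e = r * c :=
    ⟨(geodesicCurve A q t ⬝ᵥ e) / r, (mul_div_cancel₀ _ (hr ▸
      h.geodesicCurve_dotProduct_q hA ht ▸ (h.sqrt_inner_pos hA ht).ne')).symm⟩
  have hqAe : q t ⬝ᵥ (A * e) = r * (r * c) := by
    rw [h.dotProduct_mul_eq hA ht, ← h.geodesicCurve_dotProduct_q hA ht, hr, hc]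
  have hne : e - c • q t ≠ 0 := fun h0 => he <| dotProduct_self_eq_zero.1 <| by
    conv_lhs => rw [sub_eq_zero.1 h0, smul_dotProduct, ← sub_eq_zero.1 h0, hqe, smul_zero]
  have hpos := dotProduct_mul_self_pos hA hne
  rw [mul_sub, mul_smul_comm, dotProduct_sub, sub_dotProduct, sub_dotProduct, dotProduct_smul,
    dotProduct_smul, smul_dotProduct, smul_dotProduct, ← mul_dotProduct_comm A e (q t),
    dotProduct_comm (A * e) (q t), hqAe, hqq] at hpos
  rw [laxCurve, dotProduct_laxMatrix_mulVec _ _ (h.dotProduct_gam_self hA ht hp) hγe hγe, hc]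
  simp only [smul_eq_mul] at hpos
  linarith

theorem hasDerivAt_geodesicCurve_dotProduct (h : IsReducedSolution A I q p) (hA : ∀ i, 0 < A i)
    {e : ℝ → Fin n → ℝ} (he : IsTransported I (fun t => wedge (q t) (deriv q t)) e) (ht : t ∈ I)
    (hqe : q t ⬝ᵥ e t = 0) (hγe : gam A q t ⬝ᵥ e t = 0) (hp : p t ≠ 0) :
    HasDerivAt (fun u => geodesicCurve A q u ⬝ᵥ e u)
      (-(e t ⬝ᵥ deriv q t) * √(q t ⬝ᵥ (A * q t))) t := by
  have hpe : p t ⬝ᵥ e t = 0 := by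
    rw [h.gam_eq hA ht, smul_dotProduct, smul_eq_mul] at hγe
    exact (mul_eq_zero.1 hγe).resolve_left
      (inv_pos.2 (Real.sqrt_pos.2 (dotProduct_self_pos hp))).ne'
  refine (hasDerivAt_dotProduct (h.hasDerivAt_geodesicCurve hA ht)
    (he.hasDerivAt_of_dotProduct_eq_zero ht hqe)).congr_deriv ?_
  rw [smul_dotProduct, hpe, smul_zero, zero_add, dotProduct_smul,
    h.geodesicCurve_dotProduct_q hA ht, smul_eq_mul]

theorem dotProduct_laxCurve_mulVec_eq (h : IsReducedSolution A I q p) (hA : ∀ i, 0 < A i)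
    (hI : IsOpen I) (hI' : I.OrdConnected) (hp : ∀ t ∈ I, p t ≠ 0) {e f : ℝ → Fin n → ℝ}
    (he : IsTransported I (fun t => wedge (q t) (deriv q t)) e)
    (hf : IsTransported I (fun t => wedge (q t) (deriv q t)) f)
    (hqe : ∀ t ∈ I, q t ⬝ᵥ e t = 0) (hqf : ∀ t ∈ I, q t ⬝ᵥ f t = 0)
    (hγe : ∀ t ∈ I, gam A q t ⬝ᵥ e t = 0) (hγf : ∀ t ∈ I, gam A q t ⬝ᵥ f t = 0)
    {s : ℝ} (hs : s ∈ I) (ht : t ∈ I) :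
    e s ⬝ᵥ (laxCurve A q s *ᵥ f s) = e t ⬝ᵥ (laxCurve A q t *ᵥ f t) := by
  have hL : ∀ u ∈ I, e u ⬝ᵥ (laxCurve A q u *ᵥ f u) =
      e u ⬝ᵥ (A * f u) - (geodesicCurve A q u ⬝ᵥ e u) * (geodesicCurve A q u ⬝ᵥ f u) :=
    fun u hu => dotProduct_laxMatrix_mulVec _ _ (h.dotProduct_gam_self hA hu (hp u hu)) (hγe u hu)
      (hγf u hu)
  rw [hL s hs, hL t ht]
  refine eq_of_hasDerivAt_zero hI hI' (f := fun u => e u ⬝ᵥ (A * f u) -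
    (geodesicCurve A q u ⬝ᵥ e u) * (geodesicCurve A q u ⬝ᵥ f u)) (fun u hu => ?_) hs ht
  have he' := he.hasDerivAt_of_dotProduct_eq_zero hu (hqe u hu)
  have hf' := hf.hasDerivAt_of_dotProduct_eq_zero hu (hqf u hu)
  have hXe := h.hasDerivAt_geodesicCurve_dotProduct hA he hu (hqe u hu) (hγe u hu) (hp u hu)
  have hXf := h.hasDerivAt_geodesicCurve_dotProduct hA hf hu (hqf u hu) (hγf u hu) (hp u hu)
  refine ((hasDerivAt_dotProduct he' (hf'.const_mul A)).fun_sub (hXe.fun_mul hXf)).congr_deriv ?_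
  rw [mul_smul_comm, smul_dotProduct, dotProduct_smul, ← mul_dotProduct_comm A (e u),
    dotProduct_comm (A * e u), h.dotProduct_mul_eq hA hu (f u), h.dotProduct_mul_eq hA hu (e u)]
  simp only [smul_eq_mul]
  ring

end IsReducedSolution

section Spectral

theorem exists_orthonormal_eigenvectors_of_mapsTo {E : Type*} [NormedAddCommGroup E]
    [InnerProductSpace ℝ E] {T : E →ₗ[ℝ] E} (hT : T.IsSymmetric) {V : Submodule ℝ E}
    [FiniteDimensional ℝ V] (hV : ∀ x ∈ V, T x ∈ V) {m : ℕ} (hm : Module.finrank ℝ V = m) :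
    ∃ (α : Fin m → ℝ) (b : Fin m → E), Orthonormal ℝ b ∧ (∀ j, b j ∈ V) ∧
      ∀ j, T (b j) = α j • b j := by
  have hTV := hT.restrict_invariant hV
  refine ⟨hTV.eigenvalues hm, fun j => hTV.eigenvectorBasis hm j,
    (hTV.eigenvectorBasis hm).orthonormal.comp_linearIsometry V.subtypeₗᵢ, fun j => Subtype.prop _,
    fun j => congrArg Subtype.val (hTV.apply_eigenvectorBasis hm j)⟩

theorem exists_orthonormal_eigenvectors_of_kernel {ι κ : Type*} [Fintype ι] [Fintype κ]
    [DecidableEq κ] {S : Matrix ι ι ℝ} (hS : Sᵀ = S) {w : κ → ι → ℝ}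
    (hw : ∀ i j, w i ⬝ᵥ w j = if i = j then 1 else 0) (hSw : ∀ i, S *ᵥ w i = 0) {m : ℕ}
    (hm : Fintype.card κ + m = Fintype.card ι) :
    ∃ (α : Fin m → ℝ) (b : Fin m → ι → ℝ), (∀ i j, b i ⬝ᵥ b j = if i = j then 1 else 0) ∧
      (∀ i j, w i ⬝ᵥ b j = 0) ∧ ∀ j, S *ᵥ b j = α j • b j := by
  classical
  have inner_eq : ∀ x y : EuclideanSpace ℝ ι, inner ℝ x y = x.ofLp ⬝ᵥ y.ofLp := fun x y => by
    rw [EuclideanSpace.inner_eq_star_dotProduct, star_trivial, dotProduct_comm]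
  have hT : (toEuclideanLin S).IsSymmetric := isSymmetric_toEuclideanLin_iff.2 <| by
    rw [IsHermitian, conjTranspose_eq_transpose_of_trivial, hS]
  let u : κ → EuclideanSpace ℝ ι := fun i => WithLp.toLp 2 (w i)
  have hu : Orthonormal ℝ u := orthonormal_iff_ite.2 fun i j => by rw [inner_eq, hw]
  have hSu : ∀ i, toEuclideanLin S (u i) = 0 := fun i =>
    WithLp.ofLp_injective 2 (hSw i)
  let V := (Submodule.span ℝ (Set.range u))ᗮ
  have mem_V : ∀ x, x ∈ V ↔ ∀ i, inner ℝ (u i) x = 0 := fun x => by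
    rw [← Submodule.span_singleton_le_iff_mem, ← Submodule.isOrtho_iff_le,
      Submodule.isOrtho_comm, Submodule.isOrtho_span]
    simp
  have hV : ∀ x ∈ V, toEuclideanLin S x ∈ V := fun x _ => (mem_V _).2 fun i => by
    rw [← hT, hSu, inner_zero_left]
  have hfinrank : Module.finrank ℝ V = m := by
    have h := Submodule.finrank_add_finrank_orthogonal (Submodule.span ℝ (Set.range u))
    rw [finrank_span_eq_card hu.linearIndependent, finrank_euclideanSpace, ← hm] at h
    exact Nat.add_left_cancel h
  obtain ⟨α, b, hb, hbV, hSb⟩ := exists_orthonormal_eigenvectors_of_mapsTo hT hV hfinrank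
  refine ⟨α, fun j => (b j).ofLp, fun i j => ?_, fun i j => ?_, fun j =>
    congrArg WithLp.ofLp (hSb j)⟩
  · rw [← inner_eq, orthonormal_iff_ite.1 hb]
  · rw [← (mem_V _).1 (hbV j) i, inner_eq]

end Spectral

section Frame

variable {m : ℕ}

theorem forall_fin_add_two {P : Fin (m + 2) → Prop} :
    (∀ i, P i) ↔ P 0 ∧ (∀ j : Fin m, P j.castSucc.succ) ∧ P (Fin.last m).succ := by
  rw [Fin.forall_fin_succ, Fin.forall_fin_succ']

/-- The tuple `(a, c_1, …, c_m, a)`; with `a = 0` and `c = α` it lists the eigenvalues of `𝓛` on the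
vectors of a frame, with `a = 1` the factors of a rescaling of `𝔫_2, …, 𝔫_{n-1}`. -/
def withEnds (a : ℝ) (c : Fin m → ℝ) : Fin (m + 2) → ℝ :=
  Fin.cons a (Fin.snoc (α := fun _ => ℝ) c a)

variable (a : ℝ) (c : Fin m → ℝ)

theorem withEnds_zero : withEnds a c 0 = a := rfl

theorem withEnds_castSucc_succ (j : Fin m) : withEnds a c j.castSucc.succ = c j :=
  Fin.snoc_castSucc (α := fun _ => ℝ) a c j

theorem withEnds_last_succ : withEnds a c (Fin.last m).succ = a :=
  Fin.snoc_last (α := fun _ => ℝ) a c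

theorem prod_comp_withEnds {M : Type*} [CommMonoid M] (f : ℝ → M) :
    ∏ i, f (withEnds a c i) = f a ^ 2 * ∏ j, f (c j) := by
  rw [Fin.prod_univ_succ, Fin.prod_univ_castSucc]
  simp only [withEnds_zero, withEnds_castSucc_succ, withEnds_last_succ]
  rw [mul_left_comm, mul_comm, sq]

variable (A : Fin (m + 2) → ℝ) (q : ℝ → Fin (m + 2) → ℝ) (N : Fin m → ℝ → Fin (m + 2) → ℝ) (t : ℝ)

theorem frame_zero : frame A q N t 0 = q t := rfl

theorem frame_castSucc_succ (j : Fin m) : frame A q N t j.castSucc.succ = N j t :=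
  Fin.snoc_castSucc (α := fun _ => Fin (m + 2) → ℝ) (gam A q t) (fun j => N j t) j

theorem frame_last_succ : frame A q N t (Fin.last m).succ = gam A q t :=
  Fin.snoc_last (α := fun _ => Fin (m + 2) → ℝ) (gam A q t) (fun j => N j t)

variable {A q N t}

theorem frame_eq_diagonal_mul_frame {P : Fin m → ℝ → Fin (m + 2) → ℝ}
    (h : ∀ j, N j t = c j • P j t) :
    frame A q N t = diagonal (withEnds 1 c) * frame A q P t := by
  have hrow : ∀ i, frame A q N t i = withEnds 1 c i • frame A q P t i :=
    forall_fin_add_two.2 ⟨by rw [frame_zero, frame_zero, withEnds_zero, one_smul], fun j => by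
      rw [frame_castSucc_succ, frame_castSucc_succ, withEnds_castSucc_succ, h], by
      rw [frame_last_succ, frame_last_succ, withEnds_last_succ, one_smul]⟩
  ext i j
  rw [diagonal_mul, hrow]
  rfl

theorem det_frame_smul {P : Fin m → ℝ → Fin (m + 2) → ℝ} (h : ∀ j, N j t = c j • P j t) :
    (frame A q N t).det = (∏ j, c j) * (frame A q P t).det := by
  rw [frame_eq_diagonal_mul_frame c h, det_mul, det_diagonal, prod_comp_withEnds 1 c fun x => x,
    one_pow, one_mul]

theorem frame_smul_mul_transpose {P : Fin m → ℝ → Fin (m + 2) → ℝ} (h : ∀ j, N j t = c j • P j t)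
    (hc : ∀ j, c j * c j = 1) (hP : frame A q P t * (frame A q P t)ᵀ = 1) :
    frame A q N t * (frame A q N t)ᵀ = 1 := by
  have hd : ∀ i, withEnds 1 c i * withEnds 1 c i = 1 := forall_fin_add_two.2
    ⟨mul_one 1, fun j => by rw [withEnds_castSucc_succ, hc], by rw [withEnds_last_succ, mul_one]⟩
  rw [frame_eq_diagonal_mul_frame c h, transpose_mul, diagonal_transpose, Matrix.mul_assoc,
    ← Matrix.mul_assoc _ _ (diagonal _), hP, Matrix.one_mul, diagonal_mul_diagonal]
  simp only [hd, diagonal_one]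

end Frame

theorem det_mul_self_of_mul_transpose {ι : Type*} [Fintype ι] [DecidableEq ι] {g : Matrix ι ι ℝ}
    (hg : g * gᵀ = 1) : g.det * g.det = 1 := by
  rw [← det_one (n := ι), ← hg, det_mul, det_transpose]

theorem mem_SO_iff_det_pos {ι : Type*} [Fintype ι] [DecidableEq ι] {g : Matrix ι ι ℝ} :
    g ∈ specialOrthogonalGroup ι ℝ ↔ g * gᵀ = 1 ∧ 0 < g.det := by
  refine mem_SO_iff.trans (and_congr_right fun hg => ⟨fun h => h ▸ one_pos, fun h => ?_⟩)
  exact (mul_self_eq_one_iff.1 (det_mul_self_of_mul_transpose hg)).resolve_right (by linarith)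

theorem det_eqOn_one_or_neg_one {ι : Type*} [Fintype ι] [DecidableEq ι] {I : Set ℝ}
    (hI : IsPreconnected I) {g : ℝ → Matrix ι ι ℝ} (hc : ∀ i, ContinuousOn (fun t => g t i) I)
    (hg : ∀ t ∈ I, g t * (g t)ᵀ = 1) :
    (∀ t ∈ I, (g t).det = 1) ∨ ∀ t ∈ I, (g t).det = -1 :=
  hI.eq_one_or_eq_neg_one_of_sq_eq
    ((Continuous.matrix_det continuous_id).comp_continuousOn (continuousOn_pi.2 hc)) fun t ht => by
      simp only [Pi.pow_apply, Pi.one_apply, sq,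
        det_mul_self_of_mul_transpose (hg t ht)]

theorem exists_sign_eqOn_smul {ι : Type*} [Fintype ι] {I : Set ℝ} (hI : IsPreconnected I)
    {x y : ℝ → ι → ℝ} (hx : ContinuousOn x I) (hy : ContinuousOn y I)
    (hx1 : ∀ t ∈ I, x t ⬝ᵥ x t = 1) (hy1 : ∀ t ∈ I, y t ⬝ᵥ y t = 1)
    (hxy : ∀ t ∈ I, y t = (x t ⬝ᵥ y t) • x t) :
    ∃ ε : ℝ, ε * ε = 1 ∧ Set.EqOn y (fun t => ε • x t) I := by
  have hcont : ContinuousOn (fun t => x t ⬝ᵥ y t) I :=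
    (continuous_fst.dotProduct continuous_snd).comp_continuousOn (hx.prodMk hy)
  have hsq : Set.EqOn ((fun t => x t ⬝ᵥ y t) ^ 2) 1 I := fun t ht => by
    have h := hy1 t ht
    rw [hxy t ht, smul_dotProduct, dotProduct_smul, hx1 t ht] at h
    simpa only [Pi.pow_apply, Pi.one_apply, sq, smul_eq_mul, mul_one] using h
  rcases hI.eq_one_or_eq_neg_one_of_sq_eq hcont hsq with h | h
  · exact ⟨1, mul_one 1, fun t ht => (hxy t ht).trans (congrArg (· • x t) (h ht))⟩
  · exact ⟨-1, by norm_num, fun t ht => (hxy t ht).trans (congrArg (· • x t) (h ht))⟩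

namespace IsReducedSolution

variable {m : ℕ} {A : Fin (m + 2) → ℝ} {I : Set ℝ} {q p : ℝ → Fin (m + 2) → ℝ}
  {N : Fin m → ℝ → Fin (m + 2) → ℝ} {t : ℝ}

theorem frame_mul_transpose_iff (h : IsReducedSolution A I q p) (hA : ∀ i, 0 < A i) (ht : t ∈ I)
    (hp : p t ≠ 0) :
    frame A q N t * (frame A q N t)ᵀ = 1 ↔
      (∀ i j, N i t ⬝ᵥ N j t = if i = j then 1 else 0) ∧
        (∀ j, q t ⬝ᵥ N j t = 0) ∧ ∀ j, gam A q t ⬝ᵥ N j t = 0 := by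
  have hentry : frame A q N t * (frame A q N t)ᵀ = 1 ↔
      ∀ i j, frame A q N t i ⬝ᵥ frame A q N t j = if i = j then 1 else 0 := by
    rw [← Matrix.ext_iff]
    simp only [← one_apply]
    rfl
  simp only [hentry, forall_fin_add_two, frame_zero, frame_castSucc_succ, frame_last_succ,
    h.sphere t ht, h.dotProduct_gam hA ht, h.dotProduct_gam_self hA ht hp,
    dotProduct_comm _ (q t), dotProduct_comm _ (gam A q t),
    Fin.succ_inj, Fin.castSucc_inj, Fin.succ_ne_zero, (Fin.succ_ne_zero _).symm,
    (Fin.castSucc_lt_last _).ne, (Fin.castSucc_lt_last _).ne', if_true, if_false]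
  simp only [true_and, and_true, forall_and]
  tauto

theorem laxCurve_mulVec_frame (h : IsReducedSolution A I q p) (hA : ∀ i, 0 < A i) (ht : t ∈ I)
    (hp : p t ≠ 0) {α : Fin m → ℝ} (hN : ∀ j, laxCurve A q t *ᵥ N j t = α j • N j t) :
    ∀ i, laxCurve A q t *ᵥ frame A q N t i = withEnds 0 α i • frame A q N t i :=
  forall_fin_add_two.2
    ⟨by rw [frame_zero, withEnds_zero, zero_smul, h.laxCurve_mulVec_q hA ht hp], fun j => by
      rw [frame_castSucc_succ, withEnds_castSucc_succ, hN], by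
      rw [frame_last_succ, withEnds_last_succ, zero_smul, h.laxCurve_mulVec_gam hA ht hp]⟩

theorem isLRSolution_frame_iff (h : IsReducedSolution A I q p) (hA : ∀ i, 0 < A i) (hI : IsOpen I)
    (hI' : I.OrdConnected) :
    IsLRSolution A I (frame A q N) (fun t => wedge (q t) (deriv q t)) ↔
      (∀ t ∈ I, frame A q N t ∈ specialOrthogonalGroup (Fin (m + 2)) ℝ) ∧
        ∀ j, IsTransported I (fun t => wedge (q t) (deriv q t)) (N j) := by
  rw [h.isLRSolution_iff hA hI fun t _ => frame_zero A q N t]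
  simp only [forall_fin_add_two, frame_zero, frame_castSucc_succ, frame_last_succ]
  exact and_congr_right fun _ =>
    ⟨fun htr => htr.2.1, fun htr => ⟨h.isTransported_q, htr, h.isTransported_gam hA hI hI'⟩⟩

theorem charpoly_laxCurve (h : IsReducedSolution A I q p) (hA : ∀ i, 0 < A i) (ht : t ∈ I)
    (hp : p t ≠ 0) {α : Fin m → ℝ} (hframe : frame A q N t * (frame A q N t)ᵀ = 1)
    (hN : ∀ j, laxCurve A q t *ᵥ N j t = α j • N j t) :
    (laxCurve A q t).charpoly =
      Polynomial.X ^ 2 * ∏ j, (Polynomial.X - Polynomial.C (α j)) := by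
  rw [charpoly_of_forall_mulVec_row hframe (h.laxCurve_mulVec_frame hA ht hp hN),
    prod_comp_withEnds 0 α fun x => Polynomial.X - Polynomial.C x, map_zero, sub_zero]

theorem eigenvalue_pos (h : IsReducedSolution A I q p) (hA : ∀ i, 0 < A i) (ht : t ∈ I)
    (hp : p t ≠ 0) {α : Fin m → ℝ} (hframe : frame A q N t * (frame A q N t)ᵀ = 1)
    (hN : ∀ j, laxCurve A q t *ᵥ N j t = α j • N j t) (j : Fin m) : 0 < α j := by
  obtain ⟨hNN, hqN, hγN⟩ := (h.frame_mul_transpose_iff hA ht hp).1 hframe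
  have hunit : N j t ⬝ᵥ N j t = 1 := by rw [hNN, if_pos rfl]
  have hpos := h.dotProduct_laxCurve_mulVec_pos hA ht hp
    (ne_zero_of_dotProduct_self_eq_one hunit) (hqN j) (hγN j)
  rwa [hN, dotProduct_smul, hunit, smul_eq_mul, mul_one] at hpos

theorem eq_dotProduct_smul_of_laxCurve_mulVec (h : IsReducedSolution A I q p)
    (hA : ∀ i, 0 < A i) (ht : t ∈ I) (hp : p t ≠ 0) {α : Fin m → ℝ} (hα : Function.Injective α)
    (hframe : frame A q N t * (frame A q N t)ᵀ = 1)
    (hN : ∀ j, laxCurve A q t *ᵥ N j t = α j • N j t) {j : Fin m} {y : Fin (m + 2) → ℝ}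
    (hy : laxCurve A q t *ᵥ y = α j • y) : y = (N j t ⬝ᵥ y) • N j t := by
  have hne : ∀ i, i ≠ j.castSucc.succ → withEnds 0 α i ≠ α j := forall_fin_add_two.2
    ⟨fun _ => (h.eigenvalue_pos hA ht hp hframe hN j).ne, fun i hij => by
      rw [withEnds_castSucc_succ]
      exact hα.ne fun hij' => hij (hij' ▸ rfl), fun _ => by
      rw [withEnds_last_succ]
      exact (h.eigenvalue_pos hA ht hp hframe hN j).ne⟩
  rw [← frame_castSucc_succ A q N t j]
  exact eq_dotProduct_smul_of_forall_ne hframe fun i hi =>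
    dotProduct_eq_zero_of_mulVec_eq_smul (transpose_laxCurve A q t)
      (h.laxCurve_mulVec_frame hA ht hp hN i) hy (hne i hi)

theorem laxCurve_mulVec_eq_smul_of_isTransported (h : IsReducedSolution A I q p)
    (hA : ∀ i, 0 < A i) (hI : IsOpen I) (hI' : I.OrdConnected) (hp : ∀ t ∈ I, p t ≠ 0)
    (hN : ∀ j, IsTransported I (fun t => wedge (q t) (deriv q t)) (N j))
    (hframe : ∀ t ∈ I, frame A q N t * (frame A q N t)ᵀ = 1) {α : Fin m → ℝ} {t₀ : ℝ}
    (ht₀ : t₀ ∈ I) (h₀ : ∀ j, laxCurve A q t₀ *ᵥ N j t₀ = α j • N j t₀) (ht : t ∈ I)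
    (j : Fin m) : laxCurve A q t *ᵥ N j t = α j • N j t := by
  have hON := fun s hs => (h.frame_mul_transpose_iff hA hs (hp s hs)).1 (hframe s hs)
  have hS := transpose_laxCurve A q t
  refine eq_of_forall_dotProduct_row_eq (hframe t ht) (forall_fin_add_two.2 ⟨?_, fun i => ?_, ?_⟩)
  · rw [frame_zero, dotProduct_smul, (hON t ht).2.1, smul_zero,
      dotProduct_mulVec_eq_zero_of_mulVec_eq_zero hS (h.laxCurve_mulVec_q hA ht (hp t ht))]
  · rw [frame_castSucc_succ, h.dotProduct_laxCurve_mulVec_eq hA hI hI' hp (hN i) (hN j)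
      (fun s hs => (hON s hs).2.1 i) (fun s hs => (hON s hs).2.1 j)
      (fun s hs => (hON s hs).2.2 i) (fun s hs => (hON s hs).2.2 j) ht ht₀, h₀, dotProduct_smul,
      dotProduct_smul, (hON t ht).1, (hON t₀ ht₀).1]
  · rw [frame_last_succ, dotProduct_smul, (hON t ht).2.2, smul_zero,
      dotProduct_mulVec_eq_zero_of_mulVec_eq_zero hS (h.laxCurve_mulVec_gam hA ht (hp t ht))]

theorem exists_isTransported_eigenvectors (h : IsReducedSolution A I q p) (hA : ∀ i, 0 < A i)
    (hI : IsOpen I) (hI' : I.OrdConnected) (hp : ∀ t ∈ I, p t ≠ 0) {t₀ : ℝ} (ht₀ : t₀ ∈ I) :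
    ∃ (α : Fin m → ℝ) (N : Fin m → ℝ → Fin (m + 2) → ℝ),
      (∀ j, IsTransported I (fun t => wedge (q t) (deriv q t)) (N j)) ∧
      (∀ t ∈ I, frame A q N t * (frame A q N t)ᵀ = 1) ∧
      ∀ t ∈ I, ∀ j, laxCurve A q t *ᵥ N j t = α j • N j t := by
  have hqγ := h.dotProduct_gam hA ht₀
  have hw : ∀ i j, ![q t₀, gam A q t₀] i ⬝ᵥ ![q t₀, gam A q t₀] j = if i = j then 1 else 0 := by
    simp [Fin.forall_fin_two, h.sphere t₀ ht₀, hqγ, dotProduct_comm (gam A q t₀) (q t₀),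
      h.dotProduct_gam_self hA ht₀ (hp t₀ ht₀)]
  obtain ⟨α, b, hb, hwb, hLb⟩ := exists_orthonormal_eigenvectors_of_kernel (m := m)
    (transpose_laxCurve A q t₀) hw
    (Fin.forall_fin_two.2 ⟨h.laxCurve_mulVec_q hA ht₀ (hp t₀ ht₀),
      h.laxCurve_mulVec_gam hA ht₀ (hp t₀ ht₀)⟩) (by simp [add_comm])
  choose N hN₀ hN using fun j =>
    exists_isTransported hI hI' (h.continuousOn_omega hA hI) ht₀ (b j)
  have hω : ∀ t ∈ I, (wedge (q t) (deriv q t))ᵀ = -wedge (q t) (deriv q t) :=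
    fun _ _ => transpose_wedge _ _
  have hframe : ∀ t ∈ I, frame A q N t * (frame A q N t)ᵀ = 1 := fun t ht => by
    refine (h.frame_mul_transpose_iff hA ht (hp t ht)).2
      ⟨fun i j => ?_, fun j => ?_, fun j => ?_⟩
    · rw [(hN i).dotProduct_eq (hN j) hI hI' hω ht ht₀, hN₀, hN₀, hb]
    · rw [h.isTransported_q.dotProduct_eq (hN j) hI hI' hω ht ht₀, hN₀]
      exact hwb 0 j
    · rw [(h.isTransported_gam hA hI hI').dotProduct_eq (hN j) hI hI' hω ht ht₀, hN₀]
      exact hwb 1 j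
  exact ⟨α, N, hN, hframe, fun t ht => h.laxCurve_mulVec_eq_smul_of_isTransported hA hI hI' hp hN
    hframe ht₀ (fun j => by rw [hN₀]; exact hLb j) ht⟩

theorem isNormalFamily_and_isLRSolution_frame (h : IsReducedSolution A I q p)
    (hA : ∀ i, 0 < A i) (hI : IsOpen I) (hI' : I.OrdConnected) (hp : ∀ t ∈ I, p t ≠ 0)
    (hN : ∀ j, IsTransported I (fun t => wedge (q t) (deriv q t)) (N j))
    (hframe : ∀ t ∈ I, frame A q N t * (frame A q N t)ᵀ = 1) {α : Fin m → ℝ}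
    (hα : ∀ t ∈ I, ∀ j, laxCurve A q t *ᵥ N j t = α j • N j t)
    (hdet : ∀ t ∈ I, 0 < (frame A q N t).det) :
    IsNormalFamily A I q α N ∧
      IsLRSolution A I (frame A q N) (fun t => wedge (q t) (deriv q t)) := by
  refine ⟨⟨fun j => (hN j).continuousOn, fun t ht j => ?_, hα, hdet⟩,
    (h.isLRSolution_frame_iff hA hI hI').2
      ⟨fun t ht => mem_SO_iff_det_pos.2 ⟨hframe t ht, hdet t ht⟩, hN⟩⟩
  rw [((h.frame_mul_transpose_iff hA ht (hp t ht)).1 (hframe t ht)).1, if_pos rfl]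

theorem exists_isNormalFamily_isLRSolution (h : IsReducedSolution A I q p) (hm : 0 < m)
    (hA : ∀ i, 0 < A i) (hI : IsOpen I) (hI' : I.OrdConnected) (hp : ∀ t ∈ I, p t ≠ 0) {t₀ : ℝ}
    (ht₀ : t₀ ∈ I) :
    ∃ (α : Fin m → ℝ) (N : Fin m → ℝ → Fin (m + 2) → ℝ), IsNormalFamily A I q α N ∧
      IsLRSolution A I (frame A q N) (fun t => wedge (q t) (deriv q t)) := by
  obtain ⟨α, N, hN, hframe, hα⟩ := h.exists_isTransported_eigenvectors hA hI hI' hp ht₀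
  have hcont : ∀ i, ContinuousOn (fun t => frame A q N t i) I := by
    simp only [forall_fin_add_two, frame_zero, frame_castSucc_succ, frame_last_succ]
    exact ⟨h.isTransported_q.continuousOn, fun j => (hN j).continuousOn,
      (h.isTransported_gam hA hI hI').continuousOn⟩
  rcases det_eqOn_one_or_neg_one hI'.isPreconnected hcont hframe with hdet | hdet
  · exact ⟨α, N, h.isNormalFamily_and_isLRSolution_frame hA hI hI' hp hN hframe hα
      fun t ht => by rw [hdet t ht]; exact one_pos⟩
  · let c : Fin m → ℝ := Pi.mulSingle ⟨0, hm⟩ (-1)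
    have hc : ∀ j, c j * c j = 1 := fun j => by
      simp only [c, Pi.mulSingle_apply]
      split_ifs <;> norm_num
    have hprod : ∏ j, c j = -1 := by simp [c]
    refine ⟨α, fun j t => c j • N j t, h.isNormalFamily_and_isLRSolution_frame hA hI hI' hp
      (fun j => (hN j).const_smul (c j))
      (fun t ht => frame_smul_mul_transpose c (fun _ => rfl) hc (hframe t ht))
      (fun t ht j => by rw [mulVec_smul, hα t ht, smul_comm]) fun t ht => ?_⟩
    rw [det_frame_smul c fun _ => rfl, hprod, hdet t ht]
    norm_num

variable {α : Fin m → ℝ}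

theorem isLRSolution_of_isNormalFamily (h : IsReducedSolution A I q p) (hA : ∀ i, 0 < A i)
    (hI : IsOpen I) (hI' : I.OrdConnected) (hp : ∀ t ∈ I, p t ≠ 0) (hα : Function.Injective α)
    {P : Fin m → ℝ → Fin (m + 2) → ℝ} (hP : IsNormalFamily A I q α P)
    (hLR : IsLRSolution A I (frame A q P) (fun t => wedge (q t) (deriv q t)))
    (hN : IsNormalFamily A I q α N) :
    IsLRSolution A I (frame A q N) (fun t => wedge (q t) (deriv q t)) := by
  have hsign : ∀ j, ∃ ε : ℝ, ε * ε = 1 ∧ Set.EqOn (N j) (fun t => ε • P j t) I := fun j =>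
    exists_sign_eqOn_smul hI'.isPreconnected (hP.continuousOn j) (hN.continuousOn j)
      (fun t ht => hP.unit t ht j) (fun t ht => hN.unit t ht j) fun t ht =>
      h.eq_dotProduct_smul_of_laxCurve_mulVec hA ht (hp t ht) hα (hLR.mul_transpose ht)
        (hP.eigenvector t ht) (hN.eigenvector t ht j)
  choose ε hε hNP using hsign
  have htr := ((h.isLRSolution_frame_iff hA hI hI').1 hLR).2
  exact (h.isLRSolution_frame_iff hA hI hI').2 ⟨fun t ht => mem_SO_iff_det_pos.2
    ⟨frame_smul_mul_transpose ε (fun j => hNP j ht) hε (hLR.mul_transpose ht), hN.oriented t ht⟩,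
    fun j => ((htr j).const_smul (ε j)).congr hI (hNP j)⟩

theorem exists_touchesAt (h : IsReducedSolution A I q p) (hA : ∀ i, 0 < A i) (ht : t ∈ I)
    (hp : p t ≠ 0) (hframe : frame A q N t * (frame A q N t)ᵀ = 1) {j : Fin m}
    (hN : laxCurve A q t *ᵥ N j t = α j • N j t) (hj : ∀ i, α j ≠ A i) :
    ∃ y w, TouchesAt A (α j) (geodesicCurve A q t) (gam A q t) y w := by
  obtain ⟨hNN, -, hγN⟩ := (h.frame_mul_transpose_iff hA ht hp).1 hframe
  have hunit : N j t ⬝ᵥ N j t = 1 := by rw [hNN, if_pos rfl]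
  exact exists_touchesAt_of_laxMatrix_mulVec hj (h.dotProduct_gam_self hA ht hp)
    (ne_zero_of_dotProduct_self_eq_one hunit) (hγN j) hN

theorem exists_eq_smul_quadricNormal (h : IsReducedSolution A I q p) (hA : ∀ i, 0 < A i)
    (ht : t ∈ I) (hp : p t ≠ 0) (hα : Function.Injective α)
    (hframe : frame A q N t * (frame A q N t)ᵀ = 1)
    (hN : ∀ j, laxCurve A q t *ᵥ N j t = α j • N j t) {j : Fin m} (hj : ∀ i, α j ≠ A i)
    {y : Fin (m + 2) → ℝ} {w : ℝ}
    (hy : TouchesAt A (α j) (geodesicCurve A q t) (gam A q t) y w) :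
    ∃ c : ℝ, N j t = c • quadricNormal A (α j) y := by
  have hsmul := h.eq_dotProduct_smul_of_laxCurve_mulVec hA ht hp hα hframe hN
    (hy.laxMatrix_mulVec_quadricNormal hj (h.dotProduct_gam_self hA ht hp))
  have hc : N j t ⬝ᵥ quadricNormal A (α j) y ≠ 0 := fun h0 =>
    hy.quadricNormal_ne_zero hj (by rw [hsmul, h0, zero_smul])
  exact ⟨_, (inv_smul_eq_iff₀ hc).2 hsmul |>.symm⟩

end IsReducedSolution

section Rotation

variable {k : ℕ} (R : Matrix (Fin k) (Fin k) ℝ)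

/-- The image of `R` under the embedding `SO(k) ⊂ SO(k + 1)` onto the stabilizer of the first basis
vector. -/
def fixFirst : Matrix (Fin (k + 1)) (Fin (k + 1)) ℝ :=
  Matrix.of (Fin.cons (Fin.cons 1 0) fun i => Fin.cons 0 (R i))

theorem eq_fixFirst_submatrix {S : Matrix (Fin (k + 1)) (Fin (k + 1)) ℝ} (h00 : S 0 0 = 1)
    (hrow : ∀ j : Fin k, S 0 j.succ = 0) (hcol : ∀ i : Fin k, S i.succ 0 = 0) :
    S = fixFirst (S.submatrix Fin.succ Fin.succ) := by
  rw [← Matrix.ext_iff]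
  simp only [Fin.forall_fin_succ (n := k)]
  exact ⟨⟨h00, hrow⟩, fun i => ⟨hcol i, fun _ => rfl⟩⟩

theorem det_fixFirst : (fixFirst R).det = R.det := by
  rw [det_succ_row_zero, Fin.sum_univ_succ]
  simp only [fixFirst, of_apply, Fin.cons_zero, Fin.cons_succ, Pi.zero_apply, mul_zero, zero_mul,
    Finset.sum_const_zero, add_zero, Fin.val_zero, pow_zero, one_mul]
  rfl

theorem fixFirst_mul_transpose : fixFirst R * (fixFirst R)ᵀ = fixFirst (R * Rᵀ) := by
  rw [← Matrix.ext_iff]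
  simp [Fin.forall_fin_succ (n := k), mul_apply, Fin.sum_univ_succ, fixFirst]

theorem fixFirst_eq_one_iff : fixFirst R = 1 ↔ R = 1 := by
  rw [← Matrix.ext_iff, ← Matrix.ext_iff]
  simp [Fin.forall_fin_succ (n := k), fixFirst, one_apply, (Fin.succ_ne_zero _).symm]

theorem fixFirst_mem_SO_iff :
    fixFirst R ∈ specialOrthogonalGroup (Fin (k + 1)) ℝ ↔
      R ∈ specialOrthogonalGroup (Fin k) ℝ := by
  rw [mem_SO_iff, mem_SO_iff, fixFirst_mul_transpose, fixFirst_eq_one_iff, det_fixFirst]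

theorem eq_transpose_fixFirst_mul_iff {f g : Matrix (Fin (k + 1)) (Fin (k + 1)) ℝ} :
    g = (fixFirst R)ᵀ * f ↔ g 0 = f 0 ∧ ∀ j : Fin k, g j.succ = ∑ i, R i j • f i.succ := by
  have hrow : ∀ i, ((fixFirst R)ᵀ * f) i = ∑ l, fixFirst R l i • f l := fun i =>
    vecMul_eq_sum ((fixFirst R)ᵀ i) f
  have hzero : ((fixFirst R)ᵀ * f) 0 = f 0 := by
    rw [hrow, Fin.sum_univ_succ]
    simp [fixFirst]
  have hsucc : ∀ j : Fin k, ((fixFirst R)ᵀ * f) j.succ = ∑ i, R i j • f i.succ := fun j => by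
    rw [hrow, Fin.sum_univ_succ]
    simp [fixFirst]
  rw [← hzero]
  simp only [← hsucc]
  exact funext_iff.trans Fin.forall_fin_succ

theorem transpose_mem_SO {ι : Type*} [Fintype ι] [DecidableEq ι] {g : Matrix ι ι ℝ}
    (hg : g ∈ specialOrthogonalGroup ι ℝ) : gᵀ ∈ specialOrthogonalGroup ι ℝ := by
  rw [mem_SO_iff] at hg ⊢
  rw [transpose_transpose, det_transpose]
  exact ⟨mul_eq_one_comm.1 hg.1, hg.2⟩

variable {I : Set ℝ} {ω f g : ℝ → Matrix (Fin (k + 1)) (Fin (k + 1)) ℝ} {t₀ : ℝ}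

theorem exists_eq_transpose_fixFirst_mul (hI : IsOpen I) (hI' : I.OrdConnected)
    (hω : ∀ t ∈ I, (ω t)ᵀ = -ω t) (ht₀ : t₀ ∈ I)
    (hf : ∀ t ∈ I, f t ∈ specialOrthogonalGroup (Fin (k + 1)) ℝ)
    (hf' : ∀ i, IsTransported I ω fun t => f t i)
    (hg : ∀ t ∈ I, g t ∈ specialOrthogonalGroup (Fin (k + 1)) ℝ)
    (hg' : ∀ i, IsTransported I ω fun t => g t i) (hfg : g t₀ 0 = f t₀ 0) :
    ∃ R ∈ specialOrthogonalGroup (Fin k) ℝ, ∀ t ∈ I, g t = (fixFirst R)ᵀ * f t := by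
  set S := f t₀ * (g t₀)ᵀ
  have hconst : ∀ t ∈ I, f t * (g t)ᵀ = S := fun t ht => by
    ext i j
    exact (hf' i).dotProduct_eq (hg' j) hI hI' hω ht ht₀
  have hfrow := dotProduct_row_eq_ite (mem_SO_iff.1 (hf t₀ ht₀)).1
  have hgrow := dotProduct_row_eq_ite (mem_SO_iff.1 (hg t₀ ht₀)).1
  have hS0 : ∀ j, S 0 j = if 0 = j then 1 else 0 := fun j => by
    rw [← hgrow, hfg]
    rfl
  have hcol : ∀ i, S i 0 = if i = 0 then 1 else 0 := fun i => by
    rw [← hfrow, ← hfg]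
    rfl
  have hSR := eq_fixFirst_submatrix (by simpa using hS0 0)
    (fun j => (hS0 j.succ).trans (if_neg (Fin.succ_ne_zero j).symm))
    (fun i => (hcol i.succ).trans (if_neg (Fin.succ_ne_zero i)))
  refine ⟨S.submatrix Fin.succ Fin.succ, ?_, fun t ht => ?_⟩
  · rw [← fixFirst_mem_SO_iff, ← hSR]
    exact mul_mem (hf t₀ ht₀) (transpose_mem_SO (hg t₀ ht₀))
  · rw [← hSR, ← hconst t ht, transpose_mul, transpose_transpose, Matrix.mul_assoc,
      mul_eq_one_comm.1 (mem_SO_iff.1 (hf t ht)).1, Matrix.mul_one]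

theorem isTransported_const_mul (hI : IsOpen I) (S : Matrix (Fin (k + 1)) (Fin (k + 1)) ℝ)
    (hf : ∀ i, IsTransported I ω fun t => f t i) (hg : ∀ t ∈ I, g t = S * f t)
    (i : Fin (k + 1)) : IsTransported I ω fun t => g t i :=
  (IsTransported.sum fun l => (hf l).const_smul (S i l)).congr hI fun t ht => by
    rw [hg t ht]
    exact vecMul_eq_sum (S i) (f t)

end Rotation

theorem IsReducedSolution.isLRSolution_and_projectsTo_iff {k : ℕ} {A : Fin (k + 1) → ℝ} {I : Set ℝ}
    {q p : ℝ → Fin (k + 1) → ℝ} (h : IsReducedSolution A I q p) (hA : ∀ i, 0 < A i) (hI : IsOpen I)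
    (hI' : I.OrdConnected) {t₀ : ℝ} (ht₀ : t₀ ∈ I)
    {f : ℝ → Matrix (Fin (k + 1)) (Fin (k + 1)) ℝ}
    (hf : IsLRSolution A I f (fun t => wedge (q t) (deriv q t))) (hf0 : ∀ t ∈ I, f t 0 = q t)
    (g ω : ℝ → Matrix (Fin (k + 1)) (Fin (k + 1)) ℝ) :
    IsLRSolution A I g ω ∧ ProjectsTo A I g ω q p ↔
      (∀ t ∈ I, ω t = wedge (q t) (deriv q t) ∧ g t 0 = q t) ∧
        ∃ R ∈ specialOrthogonalGroup (Fin k) ℝ, ∀ t ∈ I, ∀ j : Fin k,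
          g t j.succ = ∑ i : Fin k, R i j • f t i.succ := by
  rw [h.isLRSolution_and_projectsTo_iff_isTransported hA hI]
  refine and_congr_right fun hg0 => ⟨fun ⟨hg, hg'⟩ => ?_, fun ⟨R, hR, hgR⟩ => ?_⟩
  · obtain ⟨R, hR, hgR⟩ := exists_eq_transpose_fixFirst_mul hI hI' (fun _ _ => transpose_wedge _ _)
      ht₀ hf.mem_SO hf.isTransported hg hg' ((hg0 t₀ ht₀).2.trans (hf0 t₀ ht₀).symm)
    exact ⟨R, hR, fun t ht => ((eq_transpose_fixFirst_mul_iff R).1 (hgR t ht)).2⟩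
  · have hg : ∀ t ∈ I, g t = (fixFirst R)ᵀ * f t := fun t ht =>
      (eq_transpose_fixFirst_mul_iff R).2 ⟨(hg0 t ht).2.trans (hf0 t ht).symm, hgR t ht⟩
    refine ⟨fun t ht => ?_, isTransported_const_mul hI _ hf.isTransported hg⟩
    rw [hg t ht]
    exact mul_mem (transpose_mem_SO ((fixFirst_mem_SO_iff R).2 hR)) (hf.mem_SO t ht)

end Veselova

end

theorem mainTheorem4 (m : ℕ) (hm : 0 < m) (A : Fin (m + 2) → ℝ) (hA : ∀ i, 0 < A i)
    (I : Set ℝ) (hI : IsOpen I) (hI' : I.OrdConnected)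
    (q p : ℝ → Fin (m + 2) → ℝ) (hqp : Veselova.IsReducedSolution A I q p)
    (t₀ : ℝ) (ht₀ : t₀ ∈ I) (hp : p t₀ ≠ 0) :
    -- `X` is a geodesic on `Q(0)`, and its arc length is related to the time by the energy `h`
    Veselova.IsGeodesicOn A 0 I (Veselova.geodesicCurve A q) ∧
    (∃ h : ℝ, 0 < h ∧ ∀ t ∈ I, Veselova.reducedLagrangian A (q t) (deriv q t) = h ∧
      √(deriv (Veselova.geodesicCurve A q) t ⬝ᵥ deriv (Veselova.geodesicCurve A q) t) =
        √((Veselova.geodesicCurve A q t ⬝ᵥ (A⁻¹ ^ 2 * Veselova.geodesicCurve A q t)) /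
          (Veselova.gam A q t ⬝ᵥ (A⁻¹ * Veselova.gam A q t))) *
        √(Veselova.detA A * (2 * h / ((A * q t) ⬝ᵥ q t)))) ∧
    -- the constants of motion `α_2, …, α_{n-1}`
    ∃ α : Fin m → ℝ,
      (∀ t ∈ I, (Veselova.laxCurve A q t).charpoly =
        Polynomial.X ^ 2 * ∏ j, (Polynomial.X - Polynomial.C (α j))) ∧
      -- some moving frame `(q, 𝔫_2, …, 𝔫_{n-1}, γ)` is a solution with `ω = q ∧ q̇`
      (∃ N, Veselova.IsNormalFamily A I q α N ∧
        Veselova.IsLRSolution A I (Veselova.frame A q N)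
          (fun t => Veselova.wedge (q t) (deriv q t))) ∧
      -- in the generic case every such frame is one, and the `𝔫_k` are normal to the `Q(α_k)`
      -- at the touching points of the tangent line of `X`
      (Function.Injective α → ∀ N, Veselova.IsNormalFamily A I q α N →
        Veselova.IsLRSolution A I (Veselova.frame A q N)
          (fun t => Veselova.wedge (q t) (deriv q t)) ∧
        ∀ j, (∀ i, α j ≠ A i) → ∀ t ∈ I,
          (∃ y w, Veselova.TouchesAt A (α j) (Veselova.geodesicCurve A q t)
            (Veselova.gam A q t) y w) ∧
          ∀ y w, Veselova.TouchesAt A (α j) (Veselova.geodesicCurve A q t)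
            (Veselova.gam A q t) y w → ∃ c : ℝ, N j t = c • Veselova.quadricNormal A (α j) y) ∧
      -- all solutions over the same reduced trajectory
      (∀ N, Veselova.IsNormalFamily A I q α N →
        Veselova.IsLRSolution A I (Veselova.frame A q N)
          (fun t => Veselova.wedge (q t) (deriv q t)) →
        ∀ g ω : ℝ → Matrix (Fin (m + 2)) (Fin (m + 2)) ℝ,
          (Veselova.IsLRSolution A I g ω ∧ Veselova.ProjectsTo A I g ω q p) ↔
          ((∀ t ∈ I, ω t = Veselova.wedge (q t) (deriv q t) ∧ g t 0 = q t) ∧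
            ∃ R ∈ Matrix.specialOrthogonalGroup (Fin (m + 1)) ℝ, ∀ t ∈ I, ∀ j : Fin (m + 1),
              g t j.succ = ∑ i : Fin (m + 1), R i j • Veselova.frame A q N t i.succ)) := by
  have hp' : ∀ t ∈ I, p t ≠ 0 := fun t ht => hqp.p_ne_zero hI hI' ht₀ hp ht
  obtain ⟨α, P, hP, hPLR⟩ := hqp.exists_isNormalFamily_isLRSolution hm hA hI hI' hp' ht₀
  refine ⟨hqp.isGeodesicOn hA hI hI' hp', hqp.exists_energy hA hI hI' hp' ht₀, α, fun t ht => ?_,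
    ⟨P, hP, hPLR⟩, fun hα N hN => ?_, fun N _ hNLR g ω => ?_⟩
  · exact hqp.charpoly_laxCurve hA ht (hp' t ht) (hPLR.mul_transpose ht) (hP.eigenvector t ht)
  · have hNLR := hqp.isLRSolution_of_isNormalFamily hA hI hI' hp' hα hP hPLR hN
    refine ⟨hNLR, fun j hj t ht => ⟨?_, fun y w hy => ?_⟩⟩
    · exact hqp.exists_touchesAt hA ht (hp' t ht) (hNLR.mul_transpose ht)
        (hN.eigenvector t ht j) hj
    · exact hqp.exists_eq_smul_quadricNormal hA ht (hp' t ht) hα (hNLR.mul_transpose ht)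
        (hN.eigenvector t ht) hj hy
  · exact hqp.isLRSolution_and_projectsTo_iff hA hI hI' ht₀ hNLR (fun _ _ => rfl) g ω
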